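/- A loop is a set with a binary operation, a two-sided unit $1$, and bijective left and right translations; it is Moufang if $(xy)(zx)=(x(yz))x$ for all $x,y,z$. The commutator $[x,y]$ and the associator $[x,y,z]$ are defined by $xy=(yx)[x,y]$ and $(xy)z=(x(yz))[x,y,z]$. The Frattini subloop $\Phi(L)$ is the normal subloop generated by all squares, commutators and associators of $L$. Here a code loop (small Frattini Moufang $2$-loop) of order $64$ means a Moufang loop $L$ with $|L|=64$ and $|\Phi(L)|=2$. A symplectic cubic space is a vector space $V$ over $\mathbb F_2$ with maps $\sigma:V\to\mathbb F_2$, $\kappa:V^2\to\mathbb F_2$ with $\kappa(u,u)=0$, and an alternating trilinear form $\alpha:V^3\to\mathbb F_2$ such that $\sigma(u+v)=\sigma(u)+\sigma(v)+\kappa(u,v)$ and $\kappa(u+v,w)=\kappa(u,w)+\kappa(v,w)+\alpha(u,v,w)$. Isomorphisms of such spaces are linear isomorphisms preserving $\sigma$, $\kappa$, $\alpha$. 1. Let $L$ be a code loop of order $64$. Identify $\Phi(L)$ with $\mathbb F_2$. Then $\sigma(\bar x)=x^2$, $\kappa(\bar x,\bar y)=[x,y]$, $\alpha(\bar x,\bar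 y,\bar z)=[x,y,z]$ are well defined on $V=L/\Phi(L)$ and make $V$ a symplectic cubic space of dimension $5$. Every symplectic cubic space of dimension $5$ with $\sigma\neq0$ arises in this way, up to isomorphism, from a code loop of order $64$, and two code loops of order $64$ are isomorphic if and only if their symplectic cubic spaces are isomorphic. 2. Up to isomorphism there are exactly $80$ nonassociative code loops of order $64$. -/

import Mathlib

open scoped Pointwise

universe u v

/-- A magma with two-sided unit is a loop if all left and right translations are bijective. -/
structure IsLoop (L : Type*) [MulOneClass L] : Prop where
  left_bijective : ∀ a : L, Function.Bijective fun x : L => a * x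
  right_bijective : ∀ a : L, Function.Bijective fun x : L => x * a

/-- The Moufang identity. -/
def IsMoufang (L : Type*) [MulOneClass L] : Prop :=
  ∀ x y z : L, (x * y) * (z * x) = (x * (y * z)) * x

/-- Subloops: subsets containing `1`, closed under multiplication and both divisions. -/
structure IsSubloop {L : Type*} [MulOneClass L] (N : Set L) : Prop where
  one_mem : (1 : L) ∈ N
  mul_mem : ∀ {a b : L}, a ∈ N → b ∈ N → a * b ∈ N
  left_div_mem : ∀ {a b : L}, a ∈ N → a * b ∈ N → b ∈ N
  right_div_mem : ∀ {a b : L}, b ∈ N → a * b ∈ N → a ∈ N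

/-- Normal subloops: `xN = Nx`, `x(yN) = (xy)N` and `(Nx)y = N(xy)` for all `x`, `y`. -/
structure IsNormalSubloop {L : Type*} [MulOneClass L] (N : Set L) : Prop
    extends IsSubloop N where
  comm : ∀ x : L, {x} * N = N * {x}
  left_assoc : ∀ x y : L, {x} * ({y} * N) = {x * y} * N
  right_assoc : ∀ x y : L, (N * {x}) * {y} = N * {x * y}

/-- All squares `x²`, all commutators (`[x,y]` is the `v` with `xy = (yx)v`) and all
associators (`[x,y,z]` is the `u` with `(xy)z = (x(yz))u`). -/
def frattiniGenerators (L : Type*) [MulOneClass L] : Set L :=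
  {w | ∃ x : L, w = x * x} ∪
  {w | ∃ x y : L, x * y = (y * x) * w} ∪
  {w | ∃ x y z : L, (x * y) * z = (x * (y * z)) * w}

/-- The Frattini subloop: the normal subloop generated by all squares, commutators and
associators. -/
def frattiniSubloop (L : Type*) [MulOneClass L] : Set L :=
  ⋂₀ {N : Set L | IsNormalSubloop N ∧ frattiniGenerators L ⊆ N}

/-- Small Frattini Moufang `2`-loops (code loops) `L` of order `2 ^ (n + 1)`
with `|Φ(L)| = 2`. -/
structure IsCodeLoop (L : Type*) [MulOneClass L] (n : ℕ) : Prop where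
  isLoop : IsLoop L
  isMoufang : IsMoufang L
  card_eq : Nat.card L = 2 ^ (n + 1)
  card_frattini : (frattiniSubloop L).ncard = 2

/-- The loop is not associative, i.e. it has a nontrivial associator. -/
def IsNonassociative (L : Type*) [MulOneClass L] : Prop :=
  ∃ x y z : L, (x * y) * z ≠ x * (y * z)

/-- A symplectic cubic structure on a vector space `V` over the field with two elements. -/
structure SymplecticCubicSpace (V : Type*) [AddCommGroup V] [Module (ZMod 2) V] where
  σ : V → ZMod 2
  κ : V → V → ZMod 2
  α : V [⋀^Fin 3]→ₗ[ZMod 2] ZMod 2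
  κ_self : ∀ u : V, κ u u = 0
  σ_add : ∀ u v : V, σ (u + v) = σ u + σ v + κ u v
  κ_add : ∀ u v w : V, κ (u + v) w = κ u w + κ v w + α ![u, v, w]

namespace SymplecticCubicSpace

/-- Isomorphism of symplectic cubic spaces: a linear isomorphism carrying `σ`, `κ`, `α` of the
first space to those of the second. -/
def Isomorphic {V W : Type*} [AddCommGroup V] [Module (ZMod 2) V] [AddCommGroup W]
    [Module (ZMod 2) W] (S : SymplecticCubicSpace V) (T : SymplecticCubicSpace W) : Prop :=
  ∃ A : V ≃ₗ[ZMod 2] W,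
    (∀ u, T.σ (A u) = S.σ u) ∧
    (∀ u v, T.κ (A u) (A v) = S.κ u v) ∧
    (∀ u v w, T.α ![A u, A v, A w] = S.α ![u, v, w])

/-- `S` is the symplectic cubic space of the loop `L`: after an identification of `L/Φ(L)` with
`V` (a surjective homomorphism `π` with kernel `Φ(L)`) and of the field with two elements with
`Φ(L)` (the homomorphism `ε`), one has `x² = σ(x̄)`, `[x,y] = κ(x̄,ȳ)` and
`[x,y,z] = α(x̄,ȳ,z̄)`. -/
def IsSpaceOf {V : Type*} [AddCommGroup V] [Module (ZMod 2) V] (S : SymplecticCubicSpace V)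
    (L : Type*) [MulOneClass L] : Prop :=
  ∃ (π : L →* Multiplicative V) (ε : Multiplicative (ZMod 2) →* L),
    Function.Surjective π ∧ (∀ x, π x = 1 ↔ x ∈ frattiniSubloop L) ∧
    Function.Injective ε ∧ Set.range ε = frattiniSubloop L ∧
    (∀ x, x * x = ε (.ofAdd (S.σ (π x).toAdd))) ∧
    (∀ x y, x * y = (y * x) * ε (.ofAdd (S.κ (π x).toAdd (π y).toAdd))) ∧
    (∀ x y z, (x * y) * z = (x * (y * z)) *
      ε (.ofAdd (S.α ![(π x).toAdd, (π y).toAdd, (π z).toAdd])))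

end SymplecticCubicSpace

/-!
Why the theorem holds.

*From loops to spaces and back.* A normal subloop of order two is central
(`IsNormalSubloop.central`), so a code loop is a central extension of the vector space
`V = L/Φ(L)` by the field with two elements, that is `V × 𝔽₂` with the product
`(u, s) (v, t) = (u + v, s + t + f u v)` for a cochain `f` (`TwistedLoop.exists_mulEquiv`).
Squares, commutators and associators are the diagonal, the symmetrization and the coboundary of
`f`. The Moufang identity and the pentagon identity force the coboundary to be alternating and
trilinear (`associator_trilinear`), and the remaining axioms of a symplectic cubic space are
formal consequences (`TwistedLoop.exists_space`).

Conversely, over a finite dimensional `V` every symplectic cubic space has the form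
`σ u = B u u u` for a trilinear form `B` (`exists_ofTrilinear`), because the values on a basis
determine the space and can be prescribed. The cochain `f u v = B u v v + B v u v + B v v u` then
has diagonal `σ`, symmetrization `κ` and coboundary `α`, and its loop is Moufang.

Two cochains with the same diagonal, symmetrization and coboundary differ by a symmetric cocycle
with zero diagonal. Such a cocycle defines an abelian group of exponent two, in which `V` splits
off, so it is a coboundary (`exists_coboundary`). Hence the space determines the loop
(`IsSpaceOf.nonempty_mulEquiv`).

*The count.* It remains to count the spaces of dimension five with `α ≠ 0` up to isomorphism. In
coordinates a space is a polynomial `σ` of degree at most three in five variables without constant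
term. It is recorded by three numbers: the cubic part gives `α`, the quadratic part `κ` and the
linear part `σ`, each on the basis, and monomials are encoded as positions of binary digits.
Transvections act on these numbers by shifts (`HasCode.transvect`), and the action on the part of
degree `d` depends only on the parts of degree at least `d`. Therefore normal forms can be reached
in three successive descents: first for `α`, where there are two nonzero classes, then for `κ`
with the class of `α` fixed, which gives sixteen pairs, and then for `σ`, which gives eighty
triples. In each descent a short list of words in transvections suffices, since every number that
is not a normal form is lowered by one of them; this is a finite check (`descent_α`, `descent_κ`,
`descent_σ`). The eighty normal forms are not isomorphic, because they are told apart by one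
numerical invariant (`tableInvariant_nodup`), the sum over all `u` of the cube of
`#{v | σ v = σ (u + v) = 1} + σ u`.
-/

/-! ### Central extensions given by cochains -/

/-- A `2`-cochain of `V` with values in the field with two elements, normalized at `0`. -/
structure NormalizedCochain (V : Type*) [AddCommGroup V] where
  toFun : V → V → ZMod 2
  zero_left : ∀ v, toFun 0 v = 0
  zero_right : ∀ v, toFun v 0 = 0

/-- The central extension of `V` by the field with two elements given by the cochain `f`, with
product `(u, s) (v, t) = (u + v, s + t + f u v)`. -/
@[ext]
structure TwistedLoop {V : Type*} [AddCommGroup V] (f : NormalizedCochain V) where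
  base : V
  fib : ZMod 2

namespace TwistedLoop

variable {V : Type*} [AddCommGroup V] {f : NormalizedCochain V}

instance : MulOneClass (TwistedLoop f) where
  mul x y := ⟨x.base + y.base, x.fib + y.fib + f.toFun x.base y.base⟩
  one := ⟨0, 0⟩
  one_mul x := TwistedLoop.ext (zero_add _) (by
    change 0 + x.fib + f.toFun 0 x.base = x.fib
    rw [f.zero_left, zero_add, add_zero])
  mul_one x := TwistedLoop.ext (add_zero _) (by
    change x.fib + 0 + f.toFun x.base 0 = x.fib
    rw [f.zero_right, add_zero, add_zero])

@[simp] theorem base_mul (x y : TwistedLoop f) : (x * y).base = x.base + y.base := rfl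
@[simp] theorem fib_mul (x y : TwistedLoop f) :
    (x * y).fib = x.fib + y.fib + f.toFun x.base y.base := rfl
@[simp] theorem base_one : (1 : TwistedLoop f).base = 0 := rfl
@[simp] theorem fib_one : (1 : TwistedLoop f).fib = 0 := rfl

theorem isLoop : IsLoop (TwistedLoop f) where
  left_bijective a := by
    refine ⟨fun x y h => ?_, fun y => ⟨⟨y.base - a.base,
      y.fib - a.fib - f.toFun a.base (y.base - a.base)⟩, ?_⟩⟩
    · have h1 := congrArg base h
      have h2 := congrArg fib h
      simp only [base_mul, fib_mul, add_right_inj] at h1 h2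
      rw [h1] at h2
      exact TwistedLoop.ext h1 (by simpa using h2)
    · ext
      · simp
      · simp only [fib_mul]; ring
  right_bijective a := by
    refine ⟨fun x y h => ?_, fun y => ⟨⟨y.base - a.base,
      y.fib - a.fib - f.toFun (y.base - a.base) a.base⟩, ?_⟩⟩
    · have h1 := congrArg base h
      have h2 := congrArg fib h
      simp only [base_mul, fib_mul, add_left_inj] at h1 h2
      rw [h1] at h2
      exact TwistedLoop.ext h1 (by simpa using h2)
    · ext
      · simp
      · simp only [fib_mul]; ring

theorem isMoufang_iff : IsMoufang (TwistedLoop f) ↔ ∀ x y z,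
    f.toFun x y + f.toFun z x + f.toFun (x + y) (z + x) =
      f.toFun y z + f.toFun x (y + z) + f.toFun (x + (y + z)) x := by
  constructor
  · intro h x y z
    have := congrArg fib (h ⟨x, 0⟩ ⟨y, 0⟩ ⟨z, 0⟩)
    simpa using this
  · intro h x y z
    ext
    · simp only [base_mul]; abel
    · simp only [fib_mul, base_mul]
      linear_combination h x.base y.base z.base

/-- The projection of the central extension onto `V`. -/
def proj (f : NormalizedCochain V) : TwistedLoop f →* Multiplicative V where
  toFun x := .ofAdd x.base
  map_one' := rfl
  map_mul' _ _ := rfl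

/-- The inclusion of the fibre over `0`. -/
def incl (f : NormalizedCochain V) : Multiplicative (ZMod 2) →* TwistedLoop f where
  toFun t := ⟨0, t.toAdd⟩
  map_one' := rfl
  map_mul' s t := by
    ext
    · simp
    · simp [f.zero_left]

/-- A loop which is an extension of `V` by a central subgroup of order two is isomorphic to
the twisted product given by the cochain `f` of a section, `s u * s v = s (u + v) * ε (f u v)`. -/
theorem exists_mulEquiv {L : Type*} [MulOneClass L] (hL : IsLoop L)
    (π : L →* Multiplicative V) (ε : Multiplicative (ZMod 2) →* L)
    (hπ : Function.Surjective π) (hε : Function.Injective ε)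
    (hker : ∀ x, π x = 1 ↔ x ∈ Set.range ε)
    (hcomm : ∀ t x, ε t * x = x * ε t)
    (hmid : ∀ x t y, (x * ε t) * y = x * (ε t * y))
    (hright : ∀ x y t, (x * y) * ε t = x * (y * ε t)) :
    ∃ (f : NormalizedCochain V) (e : L ≃* TwistedLoop f),
      (∀ x, (e x).base = (π x).toAdd) ∧ ∀ t, e (ε t) = ⟨0, t.toAdd⟩ := by
  classical
  -- a section with `s 0 = 1`, so that the cochain is normalized
  obtain ⟨s, hs, hs0⟩ : ∃ s : V → L, (∀ v, π (s v) = .ofAdd v) ∧ s 0 = 1 := by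
    choose s hs using fun v : V => hπ (.ofAdd v)
    refine ⟨Function.update s 0 1, fun v => ?_, by simp⟩
    by_cases h : v = 0
    · subst h; simp
    · simp [h, hs]
  have cancel : ∀ {a x y : L}, a * x = a * y → x = y := fun h => (hL.left_bijective _).1 h
  have key : ∀ x, ∃ t, x = s (π x).toAdd * ε t := by
    intro x
    obtain ⟨z, hz⟩ := (hL.left_bijective (s (π x).toAdd)).2 x
    have hz' : s (π x).toAdd * z = x := hz
    have h1 := congrArg π hz'
    rw [map_mul, hs, ofAdd_toAdd, mul_eq_left, hker] at h1
    obtain ⟨t, rfl⟩ := h1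
    exact ⟨t, hz'.symm⟩
  -- `τ x` is the fibre coordinate of `x`
  choose τ hτ using key
  have hπε : ∀ t, π (ε t) = 1 := fun t => (hker _).2 ⟨t, rfl⟩
  have uniq : ∀ v t, τ (s v * ε t) = t := by
    intro v t
    have h := hτ (s v * ε t)
    rw [map_mul, hπε, hs, mul_one, toAdd_ofAdd] at h
    exact (hε (cancel h)).symm
  have hτmul : ∀ x y, τ (x * y) =
      τ x * τ y * τ (s (π x).toAdd * s (π y).toAdd) := by
    intro x y
    have h : s (π x).toAdd * s (π y).toAdd = s ((π x).toAdd + (π y).toAdd) *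
        ε (τ (s (π x).toAdd * s (π y).toAdd)) := by
      have := hτ (s (π x).toAdd * s (π y).toAdd)
      rwa [map_mul, hs, hs, toAdd_mul, toAdd_ofAdd, toAdd_ofAdd] at this
    have h2 : x * y = s ((π x).toAdd + (π y).toAdd) *
        ε (τ x * τ y * τ (s (π x).toAdd * s (π y).toAdd)) := by
      calc x * y = (s (π x).toAdd * ε (τ x)) * (s (π y).toAdd * ε (τ y)) := by
            rw [← hτ x, ← hτ y]
        _ = s (π x).toAdd * (s (π y).toAdd * (ε (τ y) * ε (τ x))) := by
            rw [hmid, hcomm, hright]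
        _ = (s (π x).toAdd * s (π y).toAdd) * ε (τ y * τ x) := by
            rw [← map_mul, hright]
        _ = _ := by
            rw [h, hright, ← map_mul]
            congr 2
            rw [← h, mul_comm, mul_comm (τ y)]
    rw [h2, uniq]
  have hτs : ∀ v, τ (s v) = 1 := fun v => by
    have := uniq v 1
    rwa [map_one, mul_one] at this
  refine ⟨⟨fun u v => (τ (s u * s v)).toAdd, fun v => by simp [hs0, hτs],
    fun v => by simp [hs0, hτs]⟩, ?_⟩
  refine ⟨MulEquiv.ofBijective (⟨⟨fun x => ⟨(π x).toAdd, (τ x).toAdd⟩, ?_⟩, ?_⟩ : L →* _) ⟨?_, ?_⟩,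
    fun x => rfl, fun t => ?_⟩
  · ext
    · simp
    · have := hτs 0
      rw [hs0] at this
      simp [this]
  · intro x y
    ext
    · simp
    · simp [hτmul x y]
  · intro x y h
    have h1 := congrArg base h
    have h2 := congrArg fib h
    simp only [MonoidHom.coe_mk, OneHom.coe_mk] at h1 h2
    rw [hτ x, hτ y, h1, Multiplicative.toAdd.injective h2]
  · intro y
    refine ⟨s y.base * ε (.ofAdd y.fib), ?_⟩
    ext
    · simp [hs, hπε]
    · simp [uniq]
  · have := uniq 0 t
    rw [hs0, one_mul] at this
    ext
    · exact congrArg Multiplicative.toAdd (hπε t)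
    · exact congrArg Multiplicative.toAdd this

end TwistedLoop

/-! ### A loop is determined by its symplectic cubic space -/

/-- A symmetric cocycle with zero diagonal is a coboundary: the extension that it defines is
an abelian group of exponent two, that is a vector space, and its projection onto `V` has a
linear section. -/
theorem exists_coboundary {V : Type*} [AddCommGroup V] [Module (ZMod 2) V] (g : V → V → ZMod 2)
    (hsymm : ∀ x y, g x y = g y x) (hdiag : ∀ x, g x x = 0)
    (hcoc : ∀ x y z, g x y + g (x + y) z = g y z + g x (y + z)) :
    ∃ h : V → ZMod 2, ∀ x y, g x y = h x + h y + h (x + y) := by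
  have hz : ∀ v, g 0 v = 0 := fun v => by
    have h1 := hcoc 0 0 v
    rw [zero_add, zero_add, hdiag, zero_add] at h1
    simpa using h1
  let f : NormalizedCochain V := ⟨g, hz, fun v => by rw [hsymm, hz]⟩
  let _ : CommGroup (TwistedLoop f) :=
    { (inferInstance : MulOneClass (TwistedLoop f)) with
      mul_assoc := fun x y z => by
        ext
        · exact add_assoc _ _ _
        · have := hcoc x.base y.base z.base
          simp only [TwistedLoop.fib_mul, TwistedLoop.base_mul, f]
          linear_combination this
      mul_comm := fun x y => by
        ext
        · exact add_comm _ _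
        · simp only [TwistedLoop.fib_mul, f]
          rw [hsymm, add_comm x.fib]
      inv := id
      inv_mul_cancel := fun x => by
        ext
        · exact ZModModule.add_self x.base
        · simp [f, hdiag, CharTwo.add_self_eq_zero] }
  let _ : Module (ZMod 2) (Additive (TwistedLoop f)) := AddCommGroup.zmodModule fun x => by
    rw [two_nsmul]
    exact inv_mul_cancel x.toMul
  let φ : Additive (TwistedLoop f) →ₗ[ZMod 2] V :=
    (MonoidHom.toAdditiveLeft (TwistedLoop.proj f)).toZModLinearMap 2
  obtain ⟨r, hr⟩ := φ.exists_rightInverse_of_surjective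
    (LinearMap.range_eq_top.2 fun v => ⟨.ofMul ⟨v, 0⟩, rfl⟩)
  have hbase : ∀ v, (r v).toMul.base = v := fun v => LinearMap.congr_fun hr v
  refine ⟨fun v => (r v).toMul.fib, fun x y => ?_⟩
  have h1 : (r (x + y)).toMul.fib = (r x).toMul.fib + (r y).toMul.fib + g x y := by
    rw [map_add, toMul_add, TwistedLoop.fib_mul, hbase, hbase]
  have h2 := CharTwo.add_self_eq_zero ((r x).toMul.fib + (r y).toMul.fib)
  change _ = (r x).toMul.fib + (r y).toMul.fib + (r (x + y)).toMul.fib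
  linear_combination -h1 - h2

namespace SymplecticCubicSpace

variable {V : Type*} [AddCommGroup V] [Module (ZMod 2) V]

theorem α_zero_left (S : SymplecticCubicSpace V) (v w : V) : S.α ![0, v, w] = 0 :=
  S.α.map_coord_zero 0 rfl

theorem α_zero_mid (S : SymplecticCubicSpace V) (v w : V) : S.α ![v, 0, w] = 0 :=
  S.α.map_coord_zero 1 rfl

theorem α_zero_right (S : SymplecticCubicSpace V) (v w : V) : S.α ![v, w, 0] = 0 :=
  S.α.map_coord_zero 2 rfl

theorem κ_zero_left (S : SymplecticCubicSpace V) (w : V) : S.κ 0 w = 0 := by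
  have := S.κ_add 0 0 w
  rw [α_zero_left, add_zero] at this
  simpa using this

theorem κ_comm (S : SymplecticCubicSpace V) (u v : V) : S.κ u v = S.κ v u := by
  have h1 := S.σ_add u v
  have h2 := S.σ_add v u
  rw [add_comm v u] at h2
  linear_combination h2 - h1

/-- The space is recovered from the cochain of a section of its loop. -/
theorem IsSpaceOf.exists_mulEquiv {S : SymplecticCubicSpace V} {L : Type*} [MulOneClass L]
    (hL : IsLoop L) (h : S.IsSpaceOf L) :
    ∃ f : NormalizedCochain V, Nonempty (L ≃* TwistedLoop f) ∧
      (∀ x, f.toFun x x = S.σ x) ∧ (∀ x y, f.toFun x y = f.toFun y x + S.κ x y) ∧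
      ∀ x y z, f.toFun x y + f.toFun (x + y) z =
        f.toFun y z + f.toFun x (y + z) + S.α ![x, y, z] := by
  obtain ⟨π, ε, hπ, hker, hε, hran, hσ, hκ, hα⟩ := h
  rw [← hran] at hker
  have hπε : ∀ t, π (ε t) = 1 := fun t => (hker _).2 ⟨t, rfl⟩
  obtain ⟨f, e, he, heε⟩ := TwistedLoop.exists_mulEquiv hL π ε hπ hε hker
    (fun t x => by
      have := hκ (ε t) x
      rwa [hπε, toAdd_one, κ_zero_left, ofAdd_zero, map_one, mul_one] at this)
    (fun x t y => by
      have := hα x (ε t) y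
      rwa [hπε, toAdd_one, α_zero_mid, ofAdd_zero, map_one, mul_one] at this)
    (fun x y t => by
      have := hα x y (ε t)
      rwa [hπε, toAdd_one, α_zero_right, ofAdd_zero, map_one, mul_one] at this)
  have hs : ∀ v, ∃ x, (e x) = ⟨v, 0⟩ ∧ (π x).toAdd = v := fun v => by
    obtain ⟨x, hx⟩ := e.surjective ⟨v, 0⟩
    exact ⟨x, hx, by rw [← he, hx]⟩
  refine ⟨f, ⟨e⟩, fun v => ?_, fun v w => ?_, fun v w t => ?_⟩
  · obtain ⟨x, hx, hv⟩ := hs v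
    have := congrArg (fun y => (e y).fib) (hσ x)
    simpa [hx, hv, heε] using this
  · obtain ⟨x, hx, hv⟩ := hs v
    obtain ⟨y, hy, hw⟩ := hs w
    have := congrArg (fun y => (e y).fib) (hκ x y)
    simpa [hx, hv, hy, hw, heε, f.zero_right] using this
  · obtain ⟨x, hx, hv⟩ := hs v
    obtain ⟨y, hy, hw⟩ := hs w
    obtain ⟨z, hz, ht⟩ := hs t
    have := congrArg (fun y => (e y).fib) (hα x y z)
    simpa [hx, hv, hy, hw, hz, ht, heε, f.zero_right] using this

/-- A loop is determined by its space: the cochains of two loops with the same space differ by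
a symmetric cocycle with zero diagonal, hence by a coboundary. -/
theorem IsSpaceOf.nonempty_mulEquiv {S : SymplecticCubicSpace V} {L M : Type*} [MulOneClass L]
    [MulOneClass M] (hL : IsLoop L) (hM : IsLoop M) (hSL : S.IsSpaceOf L) (hSM : S.IsSpaceOf M) :
    Nonempty (L ≃* M) := by
  obtain ⟨f, ⟨e⟩, hf1, hf2, hf3⟩ := hSL.exists_mulEquiv hL
  obtain ⟨f', ⟨e'⟩, hf1', hf2', hf3'⟩ := hSM.exists_mulEquiv hM
  obtain ⟨h, hh⟩ := exists_coboundary (fun x y => f.toFun x y - f'.toFun x y)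
    (fun x y => by rw [hf2 x y, hf2' x y]; ring)
    (fun x => by rw [hf1, hf1', sub_self])
    (fun x y z => by linear_combination hf3 x y z - hf3' x y z)
  have h0 : h 0 = 0 := by
    have := hh 0 0
    simp only [f.zero_left, f'.zero_left, add_zero, sub_self, CharTwo.add_self_eq_zero,
      zero_add] at this
    exact this.symm
  let φ : TwistedLoop f ≃* TwistedLoop f' :=
    { toFun := fun x => ⟨x.base, x.fib + h x.base⟩
      invFun := fun x => ⟨x.base, x.fib - h x.base⟩
      left_inv := fun x => by ext <;> simp
      right_inv := fun x => by ext <;> simp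
      map_mul' := fun x y => by
        ext
        · rfl
        · have h1 := hh x.base y.base
          have h2 := CharTwo.add_self_eq_zero (h (x.base + y.base))
          simp only [TwistedLoop.fib_mul, TwistedLoop.base_mul]
          linear_combination h1 + h2 }
  exact ⟨(e.trans φ).trans e'.symm⟩

end SymplecticCubicSpace

section Frattini

variable {L M : Type*} [MulOneClass L] [MulOneClass M]

theorem IsNormalSubloop.image (φ : L ≃* M) {N : Set L} (hN : IsNormalSubloop N) :
    IsNormalSubloop (φ '' N) := by
  have him : ∀ y, ({y} : Set M) = φ '' {φ.symm y} := fun y => by simp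
  have hmem : ∀ y, y ∈ φ '' N ↔ φ.symm y ∈ N := fun y =>
    ⟨by rintro ⟨x, hx, rfl⟩; simpa using hx, fun h => ⟨_, h, by simp⟩⟩
  refine ⟨⟨?_, ?_, ?_, ?_⟩, fun x => ?_, fun x y => ?_, fun x y => ?_⟩
  · rw [hmem, map_one]; exact hN.one_mem
  · intro a b; simp only [hmem, map_mul]; exact hN.mul_mem
  · intro a b; simp only [hmem, map_mul]; exact hN.left_div_mem
  · intro a b; simp only [hmem, map_mul]; exact hN.right_div_mem
  · rw [him x, ← Set.image_mul, ← Set.image_mul, hN.comm]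
  · rw [him x, him y, him (x * y), ← Set.image_mul, ← Set.image_mul, ← Set.image_mul, map_mul,
      hN.left_assoc]
  · rw [him x, him y, him (x * y), ← Set.image_mul, ← Set.image_mul, ← Set.image_mul, map_mul,
      hN.right_assoc]

theorem map_mem_frattiniGenerators (φ : L ≃* M) {x : L} (hx : x ∈ frattiniGenerators L) :
    φ x ∈ frattiniGenerators M := by
  rcases hx with (⟨a, rfl⟩ | ⟨a, b, h⟩) | ⟨a, b, c, h⟩
  · exact .inl (.inl ⟨φ a, map_mul _ _ _⟩)
  · exact .inl (.inr ⟨φ a, φ b, by simp only [← map_mul, h]⟩)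
  · exact .inr ⟨φ a, φ b, φ c, by simp only [← map_mul, h]⟩

theorem map_mem_frattiniSubloop (φ : L ≃* M) {x : L} (hx : x ∈ frattiniSubloop L) :
    φ x ∈ frattiniSubloop M := by
  rintro N ⟨hN, hg⟩
  have := hx (φ.symm '' N) ⟨hN.image φ.symm, fun y hy =>
    ⟨φ y, hg (map_mem_frattiniGenerators φ hy), by simp⟩⟩
  obtain ⟨y, hy, rfl⟩ := this
  simpa using hy

theorem map_mem_frattiniSubloop_iff (φ : L ≃* M) {x : L} :
    φ x ∈ frattiniSubloop M ↔ x ∈ frattiniSubloop L :=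
  ⟨fun h => by simpa using map_mem_frattiniSubloop φ.symm h, map_mem_frattiniSubloop φ⟩

end Frattini

namespace SymplecticCubicSpace

variable {V W X : Type*} [AddCommGroup V] [Module (ZMod 2) V] [AddCommGroup W]
  [Module (ZMod 2) W] [AddCommGroup X] [Module (ZMod 2) X]

theorem Isomorphic.symm {S : SymplecticCubicSpace V} {T : SymplecticCubicSpace W}
    (h : S.Isomorphic T) : T.Isomorphic S := by
  obtain ⟨A, h1, h2, h3⟩ := h
  exact ⟨A.symm, fun u => by simp [← h1], fun u v => by simp [← h2],
    fun u v w => by simp [← h3]⟩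

theorem Isomorphic.trans {S : SymplecticCubicSpace V} {T : SymplecticCubicSpace W}
    {U : SymplecticCubicSpace X} (h : S.Isomorphic T) (h' : T.Isomorphic U) :
    S.Isomorphic U := by
  obtain ⟨A, h1, h2, h3⟩ := h
  obtain ⟨B, h1', h2', h3'⟩ := h'
  exact ⟨A.trans B, fun u => by simp [h1, h1'], fun u v => by simp [h2, h2'],
    fun u v w => by simp [h3, h3']⟩

/-- A space isomorphic to the space of `L` is itself a space of `L`: the projection of `L` is
composed with the isomorphism. -/
theorem IsSpaceOf.of_isomorphic {S : SymplecticCubicSpace V} {T : SymplecticCubicSpace W}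
    {L : Type*} [MulOneClass L] (h : S.Isomorphic T) (hT : T.IsSpaceOf L) : S.IsSpaceOf L := by
  obtain ⟨A, h1, h2, h3⟩ := h.symm
  obtain ⟨π, ε, hπ, hker, hε, hran, hσ, hκ, hα⟩ := hT
  have hA : ∀ x, A.toAddMonoidHom.toMultiplicative (π x) = .ofAdd (A (π x).toAdd) := fun _ => rfl
  refine ⟨A.toAddMonoidHom.toMultiplicative.comp π, ε, ?_, ?_, hε, hran, ?_, ?_, ?_⟩
  · intro v
    obtain ⟨x, hx⟩ := hπ (.ofAdd (A.symm v.toAdd))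
    exact ⟨x, by simp [hx]⟩
  · intro x
    rw [← hker, MonoidHom.comp_apply, hA, ofAdd_eq_one, map_eq_zero_iff A A.injective,
      toAdd_eq_zero]
  · simpa [hA, h1] using hσ
  · simpa [hA, h2] using hκ
  · simpa [hA, h3] using hα

/-- An isomorphism of loops respects the Frattini subloops and so induces one of the spaces. -/
theorem isomorphic_of_mulEquiv {S : SymplecticCubicSpace V} {T : SymplecticCubicSpace W}
    {L M : Type*} [MulOneClass L] [MulOneClass M] (hL : IsLoop L)
    (hS : S.IsSpaceOf L) (hT : T.IsSpaceOf M) (φ : L ≃* M) : S.Isomorphic T := by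
  obtain ⟨π, ε, hπ, hker, hε, hran, hσ, hκ, hα⟩ := hS
  obtain ⟨π', ε', hπ', hker', hε', hran', hσ', hκ', hα'⟩ := hT
  have hcase : ∀ t : Multiplicative (ZMod 2), t = 1 ∨ t = .ofAdd 1 := by decide
  -- `φ` maps the nontrivial element of `Φ(L)` to that of `Φ(M)`
  have hφε : ∀ t, φ (ε t) = ε' t := by
    have h1 : φ (ε (.ofAdd 1)) = ε' (.ofAdd 1) := by
      have h2 : φ (ε (.ofAdd 1)) ∈ Set.range ε' := by
        rw [hran', map_mem_frattiniSubloop_iff, ← hran]; exact ⟨_, rfl⟩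
      obtain ⟨t, ht⟩ := h2
      rcases hcase t with rfl | rfl
      · exfalso
        rw [map_one, eq_comm, map_eq_one_iff φ φ.injective, map_eq_one_iff ε hε] at ht
        exact absurd ht (by decide)
      · exact ht.symm
    intro t
    rcases hcase t with rfl | rfl
    · simp
    · exact h1
  choose s hs using fun v : V => hπ (.ofAdd v)
  have hiff : ∀ x, π' (φ x) = 1 ↔ π x = 1 := fun x => by
    rw [hker, hker', map_mem_frattiniSubloop_iff]
  -- `π' ∘ φ` factors through `π`
  have key : ∀ x, π' (φ (s (π x).toAdd)) = π' (φ x) := fun x => by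
    obtain ⟨z, hz⟩ := (hL.left_bijective x).2 (s (π x).toAdd)
    have hz' : x * z = s (π x).toAdd := hz
    have h1 := congrArg π hz'
    rw [map_mul, hs, ofAdd_toAdd, mul_eq_left, ← hiff] at h1
    rw [← hz', map_mul, map_mul, h1, mul_one]
  let A₀ : V →+ W :=
    { toFun := fun v => (π' (φ (s v))).toAdd
      map_zero' := by
        have := key 1
        rw [map_one π, toAdd_one, map_one φ, map_one π'] at this
        rw [this, toAdd_one]
      map_add' := fun u v => by
        have := key (s u * s v)
        rw [map_mul, hs, hs, toAdd_mul, toAdd_ofAdd, toAdd_ofAdd] at this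
        rw [this, map_mul, map_mul, toAdd_mul] }
  have hA₀ : ∀ x, A₀ (π x).toAdd = (π' (φ x)).toAdd := fun x =>
    congrArg Multiplicative.toAdd (key x)
  have hbij : Function.Bijective (A₀.toZModLinearMap 2) := by
    refine ⟨(injective_iff_map_eq_zero (A₀.toZModLinearMap 2)).2 fun v hv => ?_, fun w => ?_⟩
    · have h1 : π' (φ (s v)) = 1 := hv
      rw [hiff, hs] at h1
      exact h1
    · obtain ⟨y, hy⟩ := hπ' (.ofAdd w)
      refine ⟨(π (φ.symm y)).toAdd, ?_⟩
      have := hA₀ (φ.symm y)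
      rw [φ.apply_symm_apply, hy] at this
      exact this
  have hlift : ∀ v, ∃ x, (π x).toAdd = v ∧ (π' (φ x)).toAdd = A₀ v := fun v =>
    ⟨s v, by rw [hs, toAdd_ofAdd], rfl⟩
  have hinj : ∀ {s t : ZMod 2}, ε' (.ofAdd s) = ε' (.ofAdd t) → s = t := fun h => hε' h
  have hcancel : ∀ {y : M} {s t : ZMod 2}, φ.symm y * ε (.ofAdd s) = φ.symm y * ε (.ofAdd t) →
      s = t := fun h => hε ((hL.left_bijective _).1 h)
  refine ⟨.ofBijective _ hbij, fun u => ?_, fun u v => ?_, fun u v w => ?_⟩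
  · obtain ⟨x, rfl, hx⟩ := hlift u
    change T.σ (A₀ _) = _
    rw [← hx]
    apply hinj
    rw [← hσ', ← map_mul, hσ, hφε]
  · obtain ⟨x, rfl, hx⟩ := hlift u
    obtain ⟨y, rfl, hy⟩ := hlift v
    change T.κ (A₀ _) (A₀ _) = _
    rw [← hx, ← hy]
    apply hcancel (y := φ y * φ x)
    apply φ.injective
    simp only [map_mul, φ.apply_symm_apply, hφε]
    rw [← hκ', ← map_mul, hκ, map_mul, map_mul, hφε]
  · obtain ⟨x, rfl, hx⟩ := hlift u
    obtain ⟨y, rfl, hy⟩ := hlift v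
    obtain ⟨z, rfl, hz⟩ := hlift w
    change T.α ![A₀ _, A₀ _, A₀ _] = _
    rw [← hx, ← hy, ← hz]
    apply hcancel (y := φ x * (φ y * φ z))
    apply φ.injective
    simp only [map_mul, φ.apply_symm_apply, hφε]
    rw [← hα', ← map_mul, ← map_mul, hα, map_mul, map_mul, map_mul, hφε]

end SymplecticCubicSpace

/-! ### The quotient of a code loop by its Frattini subloop -/

section Frattini

variable {L : Type*} [MulOneClass L]

theorem frattiniGenerators_subset : frattiniGenerators L ⊆ frattiniSubloop L :=
  fun _ hx _ hN => hN.2 hx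

theorem isNormalSubloop_frattiniSubloop (hL : IsLoop L) : IsNormalSubloop (frattiniSubloop L) := by
  have inter : ∀ f g : L → L, Function.Bijective f → Function.Bijective g →
      (∀ N : Set L, IsNormalSubloop N → f '' N = g '' N) →
      f '' frattiniSubloop L = g '' frattiniSubloop L := by
    intro f g hf hg h
    rw [frattiniSubloop, Set.sInter_eq_biInter, Set.image_iInter₂ hf, Set.image_iInter₂ hg]
    exact Set.iInter₂_congr fun N hN => h N hN.1
  refine ⟨⟨fun N hN => hN.1.one_mem, fun ha hb N hN => hN.1.mul_mem (ha N hN) (hb N hN),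
    fun ha hb N hN => hN.1.left_div_mem (ha N hN) (hb N hN),
    fun ha hb N hN => hN.1.right_div_mem (ha N hN) (hb N hN)⟩, fun x => ?_, fun x y => ?_,
    fun x y => ?_⟩
  · have := inter _ _ (hL.left_bijective x) (hL.right_bijective x) fun N hN => by
      simpa using hN.comm x
    simpa using this
  · have := inter _ _ ((hL.left_bijective x).comp (hL.left_bijective y))
      (hL.left_bijective (x * y)) fun N hN => by
        simpa [Set.image_image] using hN.left_assoc x y
    simpa [Set.image_image] using this
  · have := inter _ _ ((hL.right_bijective y).comp (hL.right_bijective x))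
      (hL.right_bijective (x * y)) fun N hN => by
        simpa [Set.image_image] using hN.right_assoc x y
    simpa [Set.image_image] using this

/-- A normal subloop of order two is central. -/
theorem IsNormalSubloop.central {N : Set L} (hL : IsLoop L) (hN : IsNormalSubloop N) {e : L}
    (he : e ≠ 1) (hNe : N = {1, e}) :
    e * e = 1 ∧ (∀ x, e * x = x * e) ∧ (∀ x y, (x * e) * y = x * (e * y)) ∧
      ∀ x y, (x * y) * e = x * (y * e) := by
  have heN : e ∈ N := by simp [hNe]
  have cancel : ∀ {a x y : L}, a * x = a * y → x = y := fun h => (hL.left_bijective _).1 h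
  have cancel' : ∀ {a x y : L}, x * a = y * a → x = y := fun h => (hL.right_bijective _).1 h
  have hee : e * e = 1 := by
    have h := hN.mul_mem heN heN
    rw [hNe] at h
    rcases h with h | h
    · exact h
    · exact absurd (cancel (h.trans (mul_one e).symm)) he
  have hcomm : ∀ x, e * x = x * e := by
    intro x
    have h : x * e ∈ N * {x} := hN.comm x ▸ Set.mul_mem_mul rfl heN
    rw [hNe] at h
    obtain ⟨n, rfl | rfl, y, rfl, h⟩ := h
    · exact absurd (cancel (h.symm.trans ((one_mul y).trans (mul_one y).symm))) he
    · exact h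
  have hright : ∀ x y, (x * y) * e = x * (y * e) := by
    intro x y
    have h : x * (y * e) ∈ {x * y} * N :=
      hN.left_assoc x y ▸ Set.mul_mem_mul rfl (Set.mul_mem_mul rfl heN)
    rw [hNe] at h
    obtain ⟨z, rfl, n, rfl | rfl, h⟩ := h
    · exact absurd (cancel (cancel (h.symm.trans (by simp : _ = x * (y * 1))))) he
    · exact h
  have hleft : ∀ x y, (e * x) * y = e * (x * y) := by
    intro x y
    have h : (e * x) * y ∈ N * {x * y} :=
      hN.right_assoc x y ▸ Set.mul_mem_mul (Set.mul_mem_mul heN rfl) rfl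
    rw [hNe] at h
    obtain ⟨n, rfl | rfl, z, rfl, h⟩ := h
    · exact absurd (cancel' (cancel' (h.symm.trans (by simp : _ = (1 * x) * y)))) he
    · exact h.symm
  exact ⟨hee, hcomm, fun x y => by rw [← hcomm, hleft, hcomm, hright, hcomm y], hright⟩

/-- The homomorphism from the group of order two that sends the generator to `e`. -/
def involutionHom (e : L) (he : e * e = 1) : Multiplicative (ZMod 2) →* L where
  toFun t := if t = 1 then 1 else e
  map_one' := if_pos rfl
  map_mul' := by
    have hcase : ∀ t : Multiplicative (ZMod 2), t = 1 ∨ t = .ofAdd 1 := by decide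
    have h1 : (Multiplicative.ofAdd (1 : ZMod 2)) ≠ 1 := by decide
    have h2 : (Multiplicative.ofAdd (1 : ZMod 2)) * .ofAdd 1 = 1 := by decide
    intro s t
    rcases hcase s with rfl | rfl <;> rcases hcase t with rfl | rfl <;> simp [h1, h2, he]

end Frattini

/-- The quotient of a code loop by its Frattini subloop is a vector space of dimension `n` over
the field with two elements. -/
theorem IsCodeLoop.exists_extension {L : Type*} [MulOneClass L] {n : ℕ} (hL : IsCodeLoop L n) :
    ∃ (π : L →* Multiplicative (Fin n → ZMod 2)) (ε : Multiplicative (ZMod 2) →* L),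
      Function.Surjective π ∧ Function.Injective ε ∧ Set.range ε = frattiniSubloop L ∧
      (∀ x, π x = 1 ↔ x ∈ Set.range ε) ∧
      (∀ t x, ε t * x = x * ε t) ∧
      (∀ x t y, (x * ε t) * y = x * (ε t * y)) ∧
      (∀ x y t, (x * y) * ε t = x * (y * ε t)) := by
  classical
  have hN := isNormalSubloop_frattiniSubloop hL.isLoop
  obtain ⟨a, b, hab, hΦ⟩ := Set.ncard_eq_two.1 hL.card_frattini
  obtain ⟨e, he, hΦ⟩ : ∃ e : L, e ≠ 1 ∧ frattiniSubloop L = {1, e} := by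
    have h1 := hN.one_mem
    rw [hΦ] at h1
    rcases h1 with rfl | rfl
    · exact ⟨b, hab.symm, hΦ⟩
    · exact ⟨a, hab, hΦ.trans (Set.pair_comm _ _)⟩
  obtain ⟨hee, hcomm, hmid, hright⟩ := hN.central hL.isLoop he hΦ
  have hcase : ∀ t : Multiplicative (ZMod 2), t = 1 ∨ t = .ofAdd 1 := by decide
  let ε := involutionHom e hee
  have hne : (Multiplicative.ofAdd (1 : ZMod 2)) ≠ 1 := by decide
  have hε1 : ε (.ofAdd 1) = e := if_neg (t := 1) hne
  have hεrange : Set.range ε = {1, e} := by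
    ext x
    constructor
    · rintro ⟨t, rfl⟩
      rcases hcase t with rfl | rfl
      · simp
      · simp [hε1]
    · rintro (rfl | rfl)
      · exact ⟨1, map_one ε⟩
      · exact ⟨_, hε1⟩
  have hεinj : Function.Injective ε := by
    intro s t h
    rcases hcase s with rfl | rfl <;> rcases hcase t with rfl | rfl
    · rfl
    · rw [hε1, map_one] at h; exact absurd h.symm he
    · rw [hε1, map_one] at h; exact absurd h he
    · rfl
  have hεcomm : ∀ t x, ε t * x = x * ε t := by
    intro t x
    rcases hcase t with rfl | rfl
    · simp
    · rw [hε1, hcomm]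
  have hεmid : ∀ x t y, (x * ε t) * y = x * (ε t * y) := by
    intro x t y
    rcases hcase t with rfl | rfl
    · simp
    · rw [hε1, hmid]
  have hεright : ∀ x y t, (x * y) * ε t = x * (y * ε t) := by
    intro x y t
    rcases hcase t with rfl | rfl
    · simp
    · rw [hε1, hright]
  have cancel : ∀ {a x y : L}, a * x = a * y → x = y := fun h => (hL.isLoop.left_bijective _).1 h
  have hmul : ∀ x y s t, (x * ε s) * (y * ε t) = (x * y) * ε (s * t) := by
    intro x y s t
    rw [hεmid, hεcomm, hεright, ← map_mul, mul_comm t s, hεright]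
  -- cosets of the Frattini subloop
  let c : Con L :=
    { r := fun x y => ∃ t, y = x * ε t
      iseqv := ⟨fun x => ⟨1, by simp⟩,
        by
          rintro x _ ⟨t, rfl⟩
          refine ⟨t, ?_⟩
          have : t * t = 1 := by revert t; decide
          rw [hεright, ← map_mul, this, map_one, mul_one],
        by
          rintro x _ _ ⟨s, rfl⟩ ⟨t, rfl⟩
          exact ⟨s * t, by rw [hεright, map_mul]⟩⟩
      mul' := by
        rintro x _ y _ ⟨s, rfl⟩ ⟨t, rfl⟩
        exact ⟨s * t, hmul _ _ _ _⟩ }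
  have hrel : ∀ {x y : L}, (x : c.Quotient) = y ↔ ∃ t, y = x * ε t := fun {x y} => c.eq
  have hgen : ∀ {x y w : L}, x = y * w → w ∈ frattiniGenerators L →
      (x : c.Quotient) = y := by
    intro x y w h hw
    have := frattiniGenerators_subset hw
    rw [hΦ, ← hεrange] at this
    obtain ⟨t, rfl⟩ := this
    exact (hrel.2 ⟨t, h⟩).symm
  have hdiv : ∀ a b : L, ∃ w, b = a * w := fun a b => by
    obtain ⟨w, hw⟩ := (hL.isLoop.left_bijective a).2 b
    exact ⟨w, hw.symm⟩
  let _ : CommGroup c.Quotient :=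
    { (inferInstance : MulOneClass c.Quotient) with
      mul_assoc := by
        rintro ⟨x⟩ ⟨y⟩ ⟨z⟩
        obtain ⟨w, hw⟩ := hdiv (x * (y * z)) (x * y * z)
        exact hgen hw (.inr ⟨x, y, z, hw⟩)
      mul_comm := by
        rintro ⟨x⟩ ⟨y⟩
        obtain ⟨w, hw⟩ := hdiv (y * x) (x * y)
        exact hgen hw (.inl (.inr ⟨x, y, hw⟩))
      inv := id
      inv_mul_cancel := by
        rintro ⟨x⟩
        exact hgen (y := 1) (one_mul _).symm (.inl (.inl ⟨x, rfl⟩)) }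
  let _ : Module (ZMod 2) (Additive c.Quotient) := AddCommGroup.zmodModule fun x => by
    rw [two_nsmul]
    exact inv_mul_cancel x.toMul
  have hfin : Finite L := Nat.finite_of_card_ne_zero (by rw [hL.card_eq]; positivity)
  have hfinQ : Finite c.Quotient := Quotient.finite _
  -- every coset has two elements
  have hcard : Nat.card L = Nat.card c.Quotient * 2 := by
    have : Function.Bijective
        (fun p : c.Quotient × Multiplicative (ZMod 2) => p.1.out * ε p.2) := by
      constructor
      · rintro ⟨p, s⟩ ⟨q, t⟩ h
        have h : p.out * ε s = q.out * ε t := h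
        have hpq : p = q := by
          have h1 : ((p.out * ε s : L) : c.Quotient) = p := by
            rw [← hrel.2 ⟨s, rfl⟩]; exact Quotient.out_eq p
          have h2 : ((q.out * ε t : L) : c.Quotient) = q := by
            rw [← hrel.2 ⟨t, rfl⟩]; exact Quotient.out_eq q
          rw [← h1, ← h2, h]
        subst hpq
        rw [hεinj (cancel h)]
      · intro x
        obtain ⟨t, ht⟩ := hrel.1 (Quotient.out_eq (x : c.Quotient))
        exact ⟨⟨x, t⟩, ht.symm⟩
    rw [← Nat.card_eq_of_bijective _ this, Nat.card_prod]
    simp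
  have hrank : Module.finrank (ZMod 2) (Additive c.Quotient) = n := by
    have h1 := Module.natCard_eq_pow_finrank (K := ZMod 2) (V := Additive c.Quotient)
    have h2 : Nat.card (Additive c.Quotient) = Nat.card c.Quotient := rfl
    rw [h2, Nat.card_zmod] at h1
    rw [hL.card_eq, pow_succ] at hcard
    exact Nat.pow_right_injective le_rfl (by simpa [h1] using hcard.symm)
  have hfinA : Module.Finite (ZMod 2) (Additive c.Quotient) :=
    Module.Finite.of_finite
  let A : Additive c.Quotient ≃ₗ[ZMod 2] (Fin n → ZMod 2) :=
    LinearEquiv.ofFinrankEq _ _ (by rw [hrank, Module.finrank_fin_fun])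
  refine ⟨(AddMonoidHom.toMultiplicativeRight A.toAddMonoidHom).comp c.mk', ε, ?_, hεinj,
    hεrange.trans hΦ.symm, ?_, hεcomm, hεmid, hεright⟩
  · intro v
    obtain ⟨q, hq⟩ := A.surjective v.toAdd
    obtain ⟨x, hx⟩ := c.mk'_surjective q.toMul
    refine ⟨x, ?_⟩
    change Multiplicative.ofAdd (A (.ofMul (c.mk' x))) = v
    rw [hx, ofMul_toMul, hq, ofAdd_toAdd]
  · intro x
    change Multiplicative.ofAdd (A (.ofMul (c.mk' x))) = 1 ↔ _
    rw [ofAdd_eq_one, map_eq_zero_iff A A.injective, ofMul_eq_zero]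
    change ((x : L) : c.Quotient) = ((1 : L) : c.Quotient) ↔ _
    rw [eq_comm, hrel]
    simp [eq_comm]

/-! ### Associators, commutators and squares of Moufang loops -/

section Associator

variable {V : Type*} [AddCommGroup V] [Module (ZMod 2) V]

/-- An alternating trilinear form given as a function of three vectors. -/
def AlternatingMap.ofCyclic (a : V → V → V → ZMod 2) (hcyc : ∀ x y z, a x y z = a y z x)
    (halt : ∀ x z, a x x z = 0) (hadd : ∀ x y z w, a (x + y) z w = a x z w + a y z w) :
    V [⋀^Fin 3]→ₗ[ZMod 2] ZMod 2 where
  toFun m := a (m 0) (m 1) (m 2)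
  map_update_add' {inst} m i x y := by
    obtain rfl := Subsingleton.elim (instDecidableEqFin 3) inst
    have hadd₂ : ∀ x y z w, a z (x + y) w = a z x w + a z y w := fun x y z w => by
      rw [hcyc, hadd, hcyc z x, hcyc z y]
    have hadd₃ : ∀ x y z w, a z w (x + y) = a z w x + a z w y := fun x y z w => by
      rw [hcyc, hadd₂, hcyc z w x, hcyc z w y]
    fin_cases i <;> simp [Function.update, hadd, hadd₂, hadd₃]
  map_update_smul' {inst} m i c x := by
    obtain rfl := Subsingleton.elim (instDecidableEqFin 3) inst
    have hzero : ∀ z w, a 0 z w = 0 := fun z w => by simpa using hadd 0 0 z w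
    have hzero₃ : ∀ z w, a z w 0 = 0 := fun z w => by rw [← hcyc, hzero]
    have hzero₂ : ∀ z w, a z 0 w = 0 := fun z w => by rw [← hcyc, hzero₃]
    have hc : c = 0 ∨ c = 1 := by revert c; decide
    rcases hc with rfl | rfl
    · fin_cases i <;> simp [Function.update, hzero, hzero₂, hzero₃]
    · simp
  map_eq_zero_of_eq' m i j h hij := by
    have halt₂ : ∀ x z, a z x x = 0 := fun x z => by rw [hcyc, halt]
    have halt₃ : ∀ x z, a x z x = 0 := fun x z => by rw [hcyc, halt₂]
    fin_cases i <;> fin_cases j <;> simp at h hij <;> simp [h, halt, halt₂, halt₃]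

@[simp] theorem AlternatingMap.ofCyclic_apply (a : V → V → V → ZMod 2)
    (hcyc : ∀ x y z, a x y z = a y z x) (halt : ∀ x z, a x x z = 0)
    (hadd : ∀ x y z w, a (x + y) z w = a x z w + a y z w) (x y z : V) :
    AlternatingMap.ofCyclic a hcyc halt hadd ![x, y, z] = a x y z := rfl

/-- Associators of a Moufang loop with values in a central subgroup of order two are alternating
and trilinear: the pentagon identity and the Moufang identity make `a` invariant under adding
one argument to another, hence symmetric, and then the pentagon identity shows that the three
polarizations of `a` are equal with sum zero. -/
theorem associator_trilinear (a : V → V → V → ZMod 2) (hzero : ∀ x y, a x y 0 = 0)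
    (hflex : ∀ x y, a x y x = 0) (hmouf : ∀ x y z, a x y (z + x) = a y z x)
    (hpent : ∀ x y z w, a y z w + a (x + y) z w + a x (y + z) w + a x y (z + w) + a x y z = 0) :
    (∀ x y z, a x y z = a y z x) ∧ (∀ x z, a x x z = 0) ∧
      (∀ x y z, a x y z = a x z y) ∧ ∀ x y z w, a (x + y) z w = a x z w + a y z w := by
  have self : ∀ x : V, x + x = 0 := ZModModule.add_self
  have cancel : ∀ x y : V, x + y + y = x := fun x y => by rw [add_assoc, self, add_zero]
  have hzero₁ : ∀ x y, a 0 x y = 0 := fun x y => by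
    have := hmouf 0 x y
    rwa [add_zero, hzero] at this
  have halt : ∀ x z, a x x z = 0 := fun x z => by
    have := hmouf x x (z + x)
    rwa [cancel, hflex] at this
  have halt₂ : ∀ x z, a z x x = 0 := fun x z => by
    rw [← hmouf, self, hzero]
  -- `a` is invariant under adding the first argument to the second, and so on
  have h21 : ∀ x z w, a x (x + z) w = a x z w := fun x z w => by
    have := hpent x x z w
    rw [self, hzero₁, halt, halt] at this
    grind
  have h23 : ∀ x y z, a x (y + z) z = a x y z := fun x y z => by
    have := hpent x y z z
    rw [self, hzero, halt₂, halt₂] at this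
    grind
  have hcyc : ∀ x y z, a x y z = a y z x := fun x y z => by
    have := hmouf x y (z + x)
    rwa [cancel, h23] at this
  have h12 : ∀ x y z, a (x + y) y z = a x y z := fun x y z => by
    rw [← hcyc z, h23, hcyc]
  have hswap : ∀ x y z, a x y z = a y x z := fun x y z => by
    rw [← h12 x y z, ← h21 (x + y) y z, cancel, add_comm x y, h12]
  have hswap' : ∀ x y z, a x y z = a x z y := fun x y z => by
    rw [hcyc, hswap, ← hcyc]
  refine ⟨hcyc, halt, hswap', ?_⟩
  -- the polarization of `a` in one argument is symmetric in all four vectors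
  obtain ⟨D, hD⟩ : ∃ D : V → V → V → V → ZMod 2,
      ∀ x y z w, D x y z w = a (x + y) z w + a x z w + a y z w := ⟨_, fun _ _ _ _ => rfl⟩
  have hDl : ∀ x y z w, D x y z w = D y x z w := fun x y z w => by
    rw [hD, hD, add_comm y x]; ring
  have hDr : ∀ x y z w, D x y z w = D x y w z := fun x y z w => by
    simp only [hD, hswap' _ z w]
  have hsum : ∀ x y z w, D x y z w + D y z x w + D z w x y = 0 := fun x y z w => by
    have h := hpent x y z w
    rw [hswap x (y + z) w, ← hcyc (z + w) x y] at h
    have h1 := hcyc z x y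
    have h2 := hcyc w x y
    have h3 := hswap x y w
    have h4 := hswap x z w
    rw [hD, hD, hD]
    grind
  have hex : ∀ x y z w, D y z x w = D x z y w := fun x y z w => by
    have h1 := hsum x y z w
    have h2 := hsum y x z w
    rw [hDl y x, hDr z w y x] at h2
    grind
  intro x y z w
  have h1 : D y z x w = D x y z w := by rw [hDl, hex, hDl, hDl, hDl]
  have h2 : D z w x y = D x y z w := by
    rw [hex x z w y, hDr x w, hDl x w, hex y w x z, hDl y x, hDr x y]
  have h3 := hsum x y z w
  rw [h1, h2, hD] at h3
  grind

end Associator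

/-- A Moufang loop that is an extension of `V` by a central subgroup of order two makes `V` a
symplectic cubic space. -/
theorem TwistedLoop.exists_space {V : Type*} [AddCommGroup V] [Module (ZMod 2) V]
    (f : NormalizedCochain V) (hf : IsMoufang (TwistedLoop f)) :
    ∃ S : SymplecticCubicSpace V, (∀ x, S.σ x = f.toFun x x) ∧
      (∀ x y, S.κ x y = f.toFun x y + f.toFun y x) ∧
      ∀ x y z, S.α ![x, y, z] =
        f.toFun x y + f.toFun (x + y) z + f.toFun y z + f.toFun x (y + z) := by
  have hflex : ∀ x y, f.toFun x y + f.toFun (x + y) x + f.toFun y x + f.toFun x (y + x) = 0 := by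
    intro x y
    have := TwistedLoop.isMoufang_iff.1 hf x 0 y
    rw [f.zero_left, f.zero_right, add_zero, zero_add] at this
    rw [zero_add, zero_add, add_comm x y] at this
    rw [add_comm x y]
    grind
  obtain ⟨hcyc, halt, hswap, hadd⟩ := associator_trilinear
    (fun x y z => f.toFun x y + f.toFun (x + y) z + f.toFun y z + f.toFun x (y + z))
    (fun x y => by
      simp only [f.zero_right, add_zero]
      exact CharTwo.add_self_eq_zero _)
    hflex
    (fun x y z => by
      have h1 := TwistedLoop.isMoufang_iff.1 hf x y z
      have h2 := hflex x (y + z)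
      rw [← add_assoc] at h1
      simp only [← add_assoc] at h2 ⊢
      grind)
    (fun x y z w => by
      simp only [← add_assoc]
      grind)
  have self : ∀ x : V, x + x = 0 := ZModModule.add_self
  refine ⟨⟨fun x => f.toFun x x, fun x y => f.toFun x y + f.toFun y x,
    .ofCyclic _ hcyc halt hadd, fun u => CharTwo.add_self_eq_zero _, fun u v => ?_,
    fun u v w => ?_⟩, fun _ => rfl, fun _ _ => rfl, fun _ _ _ => rfl⟩
  -- `α v u u = 0` and `α (u + v) u v = 0`
  · have h1 := hcyc u u v
    rw [halt, hcyc] at h1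
    have h2 := hadd u v u v
    rw [halt, hcyc v u v, hcyc u v v, halt] at h2
    have huv : u + v + u = v := by rw [add_right_comm, self, zero_add]
    simp only [self, f.zero_right, huv, add_comm v u] at h1 h2
    grind
  -- the sum of the coboundary over `(u, v, w)`, `(u, w, v)` and `(w, u, v)`
  · rw [AlternatingMap.ofCyclic_apply]
    have h1 := hswap u v w
    have h2 := hcyc w u v
    simp only [add_comm w] at h1 h2 ⊢
    grind

/-! ### Code loops with a given symplectic cubic space -/

theorem IsMoufang.of_mulEquiv {L M : Type*} [MulOneClass L] [MulOneClass M] (φ : L ≃* M)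
    (hL : IsMoufang L) : IsMoufang M := fun x y z => by
  apply φ.symm.injective
  simp only [map_mul]
  exact hL _ _ _

theorem IsCodeLoop.exists_isSpaceOf {L : Type*} [MulOneClass L] {n : ℕ} (hL : IsCodeLoop L n) :
    ∃ S : SymplecticCubicSpace (Fin n → ZMod 2), S.IsSpaceOf L := by
  obtain ⟨π, ε, hπ, hε, hran, hker, hcomm, hmid, hright⟩ := hL.exists_extension
  obtain ⟨f, e, he, heε⟩ := TwistedLoop.exists_mulEquiv hL.isLoop π ε hπ hε hker hcomm hmid hright
  obtain ⟨S, hσ, hκ, hα⟩ := TwistedLoop.exists_space f (hL.isMoufang.of_mulEquiv e)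
  have self : ∀ x : Fin n → ZMod 2, x + x = 0 := ZModModule.add_self
  refine ⟨S, π, ε, hπ, fun x => by rw [hker, hran], hε, hran, fun x => ?_, fun x y => ?_,
    fun x y z => ?_⟩
  · apply e.injective
    rw [map_mul, heε]
    ext1
    · simp [self]
    · simp only [TwistedLoop.fib_mul, toAdd_ofAdd, hσ, he]
      grind
  · apply e.injective
    rw [map_mul, map_mul, map_mul, heε]
    ext1
    · simp [add_comm]
    · simp only [TwistedLoop.fib_mul, toAdd_ofAdd, hκ, he, f.zero_right]
      grind
  · apply e.injective
    simp only [map_mul]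
    rw [heε]
    ext1
    · simp [add_assoc]
    · simp only [TwistedLoop.fib_mul, TwistedLoop.base_mul, toAdd_ofAdd, hα, he, f.zero_right]
      grind

/-- The central extension given by a cochain `f` whose diagonal, symmetrization and coboundary
are the nonzero form `σ` and the forms `κ` and `α` of `S`. -/
theorem TwistedLoop.isSpaceOf {V : Type*} [AddCommGroup V] [Module (ZMod 2) V]
    (S : SymplecticCubicSpace V) (f : NormalizedCochain V) (hS : S.σ ≠ 0)
    (hσ : ∀ x, f.toFun x x = S.σ x) (hκ : ∀ x y, f.toFun x y = f.toFun y x + S.κ x y)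
    (hα : ∀ x y z, f.toFun x y + f.toFun (x + y) z =
        f.toFun y z + f.toFun x (y + z) + S.α ![x, y, z]) :
    S.IsSpaceOf (TwistedLoop f) ∧ (frattiniSubloop (TwistedLoop f)).ncard = 2 := by
  have self : ∀ x : V, x + x = 0 := ZModModule.add_self
  have hnormal : IsNormalSubloop {x : TwistedLoop f | x.base = 0} := by
    have hl : ∀ x : TwistedLoop f, {x} * {y : TwistedLoop f | y.base = 0} =
        {y | y.base = x.base} := fun x => by
      ext y
      simp only [Set.singleton_mul, Set.mem_image, Set.mem_ofPred_eq]
      refine ⟨?_, fun h => ⟨⟨0, y.fib - x.fib⟩, rfl, ?_⟩⟩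
      · rintro ⟨z, hz, rfl⟩; simp [hz]
      · ext <;> simp [h, f.zero_right]
    have hr : ∀ x : TwistedLoop f, {y : TwistedLoop f | y.base = 0} * {x} =
        {y | y.base = x.base} := fun x => by
      ext y
      simp only [Set.mul_singleton, Set.mem_image, Set.mem_ofPred_eq]
      refine ⟨?_, fun h => ⟨⟨0, y.fib - x.fib⟩, rfl, ?_⟩⟩
      · rintro ⟨z, hz, rfl⟩; simp [hz]
      · ext <;> simp [h, f.zero_left]
    refine ⟨⟨rfl, ?_, ?_, ?_⟩, fun x => by rw [hl, hr], fun x y => ?_, fun x y => ?_⟩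
    · simp only [Set.mem_ofPred_eq, base_mul]
      rintro a b ha hb
      rw [ha, hb, add_zero]
    · simp only [Set.mem_ofPred_eq, base_mul]
      rintro a b ha hb
      rwa [ha, zero_add] at hb
    · simp only [Set.mem_ofPred_eq, base_mul]
      rintro a b ha hb
      rwa [ha, add_zero] at hb
    · rw [hl, hl]
      ext z
      simp only [Set.singleton_mul, Set.mem_image, Set.mem_ofPred_eq, base_mul]
      refine ⟨?_, fun h => ?_⟩
      · rintro ⟨w, hw, rfl⟩; simp [hw]
      · obtain ⟨w, rfl⟩ := (isLoop.left_bijective x).2 z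
        exact ⟨w, by simpa using h, rfl⟩
    · rw [hr, hr]
      ext z
      simp only [Set.mul_singleton, Set.mem_image, Set.mem_ofPred_eq, base_mul]
      refine ⟨?_, fun h => ?_⟩
      · rintro ⟨w, hw, rfl⟩; simp [hw]
      · obtain ⟨w, rfl⟩ := (isLoop.right_bijective y).2 z
        exact ⟨w, by simpa using h, rfl⟩
  have hgen : frattiniGenerators (TwistedLoop f) ⊆ {x | x.base = 0} := by
    rintro w ((⟨x, rfl⟩ | ⟨x, y, h⟩) | ⟨x, y, z, h⟩)
    · exact self x.base
    · have := congrArg base h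
      rw [base_mul, base_mul, base_mul, add_comm y.base] at this
      simpa using this
    · have := congrArg base h
      simp only [base_mul, add_assoc] at this
      simpa using this
  -- `σ ≠ 0` makes the nontrivial element of the fibre over `0` a square
  have hΦ : frattiniSubloop (TwistedLoop f) = {x | x.base = 0} := by
    refine subset_antisymm (fun x hx => hx _ ⟨hnormal, hgen⟩) ?_
    rintro ⟨_, t⟩ rfl N ⟨hN, hgN⟩
    have ht : t = 0 ∨ t = 1 := by revert t; decide
    rcases ht with rfl | rfl
    · exact hN.one_mem
    · obtain ⟨v, hv⟩ := Function.ne_iff.1 hS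
      have hv1 : ∀ t : ZMod 2, t ≠ 0 → t = 1 := by decide
      refine hgN (.inl (.inl ⟨⟨v, 0⟩, ?_⟩))
      ext
      · simp [self]
      · simp [hσ, hv1 _ hv]
  have hmem : ∀ x : TwistedLoop f, x ∈ frattiniSubloop (TwistedLoop f) ↔ x.base = 0 := fun x => by
    rw [hΦ, Set.mem_ofPred_eq]
  refine ⟨⟨proj f, incl f, fun v => ⟨⟨v.toAdd, 0⟩, rfl⟩, fun x => (hmem x).symm, fun s t h =>
    congrArg fib h, ?_, fun x => ?_, fun x y => ?_, fun x y z => ?_⟩, ?_⟩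
  · ext x
    rw [hmem]
    refine ⟨?_, fun h => ⟨.ofAdd x.fib, TwistedLoop.ext h.symm rfl⟩⟩
    rintro ⟨t, rfl⟩
    rfl
  · ext
    · exact self x.base
    · change x.fib + x.fib + f.toFun x.base x.base = S.σ x.base
      rw [hσ, CharTwo.add_self_eq_zero, zero_add]
  · ext
    · change x.base + y.base = y.base + x.base + 0
      rw [add_zero, add_comm]
    · change x.fib + y.fib + f.toFun x.base y.base = y.fib + x.fib + f.toFun y.base x.base +
        S.κ x.base y.base + f.toFun _ 0
      rw [hκ, f.zero_right]
      ring
  · ext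
    · change x.base + y.base + z.base = x.base + (y.base + z.base) + 0
      rw [add_zero, add_assoc]
    · change x.fib + y.fib + f.toFun x.base y.base + z.fib + f.toFun (x.base + y.base) z.base =
        x.fib + (y.fib + z.fib + f.toFun y.base z.base) + f.toFun x.base (y.base + z.base) +
        S.α ![x.base, y.base, z.base] + f.toFun _ 0
      rw [f.zero_right]
      linear_combination hα x.base y.base z.base
  · rw [hΦ, Set.ncard_eq_two]
    refine ⟨1, ⟨0, 1⟩, fun h => absurd (congrArg fib h) (by simp), ?_⟩
    ext ⟨b, t⟩
    have ht : t = 0 ∨ t = 1 := by revert t; decide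
    simp only [Set.mem_ofPred_eq, Set.mem_insert_iff, Set.mem_singleton_iff, TwistedLoop.ext_iff,
      base_one, fib_one]
    tauto

namespace SymplecticCubicSpace

variable {V : Type*} [AddCommGroup V] [Module (ZMod 2) V]

/-- The symplectic cubic space with `σ u = B u u u`, for a trilinear form `B`: `κ` and `α` are the
first and the second polarization of `σ`, so `α` is the sum of `B` over the permutations of its
arguments. -/
def ofTrilinear (B : V →ₗ[ZMod 2] V →ₗ[ZMod 2] V →ₗ[ZMod 2] ZMod 2) : SymplecticCubicSpace V where
  σ u := B u u u
  κ u v := B u u v + B u v u + B v u u + B u v v + B v u v + B v v u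
  α := .ofCyclic
    (fun u v w => B u v w + B v w u + B w u v + B v u w + B u w v + B w v u)
    (fun u v w => by ring) (fun u v => by grind)
    (fun u v w t => by simp only [map_add, LinearMap.add_apply]; ring)
  κ_self u := by grind
  σ_add u v := by simp only [map_add, LinearMap.add_apply]; ring
  κ_add u v w := by
    simp only [map_add, LinearMap.add_apply, AlternatingMap.ofCyclic_apply]
    ring

/-- The cochain `B u v v + B v u v + B v v u`, linear in `u` and quadratic in `v`. Its coboundary,
symmetrization and diagonal are the forms `α`, `κ` and `σ` of `ofTrilinear B`. -/
def trilinearCochain (B : V →ₗ[ZMod 2] V →ₗ[ZMod 2] V →ₗ[ZMod 2] ZMod 2) :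
    NormalizedCochain V where
  toFun u v := B u v v + B v u v + B v v u
  zero_left v := by simp
  zero_right v := by simp

theorem ofTrilinear_isSpaceOf (B : V →ₗ[ZMod 2] V →ₗ[ZMod 2] V →ₗ[ZMod 2] ZMod 2)
    (h : (ofTrilinear B).σ ≠ 0) :
    (ofTrilinear B).IsSpaceOf (TwistedLoop (trilinearCochain B)) ∧
      (frattiniSubloop (TwistedLoop (trilinearCochain B))).ncard = 2 := by
  refine TwistedLoop.isSpaceOf _ _ h (fun x => ?_) (fun x y => ?_) (fun x y z => ?_)
  · simp only [trilinearCochain, ofTrilinear]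
    grind
  · simp only [trilinearCochain, ofTrilinear]
    grind
  · simp only [trilinearCochain, ofTrilinear, AlternatingMap.ofCyclic_apply, map_add,
      LinearMap.add_apply]
    grind

theorem trilinearCochain_isMoufang (B : V →ₗ[ZMod 2] V →ₗ[ZMod 2] V →ₗ[ZMod 2] ZMod 2) :
    IsMoufang (TwistedLoop (trilinearCochain B)) := by
  rw [TwistedLoop.isMoufang_iff]
  intro x y z
  simp only [trilinearCochain, map_add, LinearMap.add_apply]
  grind

end SymplecticCubicSpace

/-! ### Values on the standard basis -/

namespace SymplecticCubicSpace

section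

variable {V : Type*} [AddCommGroup V] [Module (ZMod 2) V] (S : SymplecticCubicSpace V)

theorem α_add (u v w t : V) : S.α ![u + v, w, t] = S.α ![u, w, t] + S.α ![v, w, t] :=
  S.α.map_vecCons_add _ _ _

theorem α_self (u w : V) : S.α ![u, u, w] = 0 :=
  S.α.map_eq_zero_of_eq _ (i := 0) (j := 1) rfl (by decide)

theorem κ_eq (u v : V) : S.κ u v = S.σ (u + v) + S.σ u + S.σ v := by
  have := S.σ_add u v
  grind

theorem α_eq (u v w : V) : S.α ![u, v, w] = S.κ (u + v) w + S.κ u w + S.κ v w := by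
  have := S.κ_add u v w
  grind

theorem α_swap (u v w : V) : S.α ![u, v, w] = S.α ![v, u, w] := by
  rw [α_eq, α_eq, add_comm u v]
  ring

theorem α_cyc (u v w : V) : S.α ![u, v, w] = S.α ![v, w, u] := by
  rw [α_eq, α_eq, κ_eq, κ_eq, κ_eq, κ_eq, κ_eq, κ_eq, add_comm (v + w) u, ← add_assoc u,
    add_comm v u, add_comm w u]
  grind

theorem κ_add_right (u v w : V) : S.κ u (v + w) = S.κ u v + S.κ u w + S.α ![u, v, w] := by
  rw [κ_comm, κ_add, S.κ_comm v, S.κ_comm w, ← α_cyc]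

end

variable {n : ℕ}

/-- The standard basis vectors. -/
abbrev stdVec (i : Fin n) : Fin n → ZMod 2 := Pi.single i 1

theorem additive_ext {φ ψ : (Fin n → ZMod 2) → ZMod 2} (hφ : ∀ u v, φ (u + v) = φ u + φ v)
    (hψ : ∀ u v, ψ (u + v) = ψ u + ψ v) (h : ∀ i, φ (stdVec i) = ψ (stdVec i))
    (u : Fin n → ZMod 2) : φ u = ψ u := by
  have hext : AddMonoidHom.mk' φ hφ = AddMonoidHom.mk' ψ hψ := by
    refine AddMonoidHom.functions_ext _ _ _ fun i x => ?_
    have hx : x = 0 ∨ x = 1 := by revert x; decide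
    rcases hx with rfl | rfl
    · rw [Pi.single_zero, map_zero, map_zero]
    · exact h i
  exact DFunLike.congr_fun hext u

theorem α_eq_of_stdVec {S T : SymplecticCubicSpace (Fin n → ZMod 2)}
    (hα : ∀ i j l, i ≠ j → j ≠ l → i ≠ l →
      S.α ![stdVec i, stdVec j, stdVec l] = T.α ![stdVec i, stdVec j, stdVec l])
    (u v w : Fin n → ZMod 2) : S.α ![u, v, w] = T.α ![u, v, w] := by
  have add₁ : ∀ (S : SymplecticCubicSpace (Fin n → ZMod 2)) w t u v,
    S.α ![u + v, w, t] = S.α ![u, w, t] + S.α ![v, w, t] := fun S w t u v => S.α_add u v w t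
  have add₂ : ∀ (S : SymplecticCubicSpace (Fin n → ZMod 2)) w t u v,
    S.α ![w, u + v, t] = S.α ![w, u, t] + S.α ![w, v, t] := fun S w t u v => by
      rw [S.α_swap, add₁, S.α_swap u, S.α_swap v]
  have add₃ : ∀ (S : SymplecticCubicSpace (Fin n → ZMod 2)) w t u v,
    S.α ![w, t, u + v] = S.α ![w, t, u] + S.α ![w, t, v] := fun S w t u v => by
      rw [S.α_cyc w t (u + v), add₂, ← S.α_cyc w t, ← S.α_cyc w t]
  refine additive_ext (φ := fun u => S.α ![u, v, w]) (ψ := fun u => T.α ![u, v, w])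
    (add₁ S v w) (add₁ T v w) (fun i => ?_) u
  refine additive_ext (φ := fun v => S.α ![stdVec i, v, w])
    (ψ := fun v => T.α ![stdVec i, v, w]) (add₂ S _ w) (add₂ T _ w) (fun j => ?_) v
  refine additive_ext (φ := fun w => S.α ![stdVec i, stdVec j, w])
    (ψ := fun w => T.α ![stdVec i, stdVec j, w]) (add₃ S _ _) (add₃ T _ _) (fun l => ?_) w
  by_cases hij : i = j
  · subst hij; rw [α_self, α_self]
  by_cases hjl : j = l
  · subst hjl; rw [α_cyc, α_self, α_cyc, α_self]
  by_cases hil : i = l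
  · subst hil; rw [← α_cyc, α_self, ← α_cyc, α_self]
  exact hα i j l hij hjl hil

/-- A symplectic cubic space is determined by its values on a basis. -/
theorem eq_of_stdVec {S T : SymplecticCubicSpace (Fin n → ZMod 2)}
    (hσ : ∀ i, S.σ (stdVec i) = T.σ (stdVec i))
    (hκ : ∀ i j, i ≠ j → S.κ (stdVec i) (stdVec j) = T.κ (stdVec i) (stdVec j))
    (hα : ∀ i j l, i ≠ j → j ≠ l → i ≠ l →
      S.α ![stdVec i, stdVec j, stdVec l] = T.α ![stdVec i, stdVec j, stdVec l]) :
    (∀ u, S.σ u = T.σ u) ∧ (∀ u v, S.κ u v = T.κ u v) ∧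
      ∀ u v w, S.α ![u, v, w] = T.α ![u, v, w] := by
  have hα' := α_eq_of_stdVec hα
  have hκ' : ∀ u v, S.κ u v = T.κ u v := by
    have h : ∀ u v, S.κ u v + T.κ u v = 0 := by
      intro u v
      refine additive_ext (φ := fun u => S.κ u v + T.κ u v) (ψ := fun _ => 0)
        (fun x y => ?_) (fun _ _ => (add_zero 0).symm) (fun i => ?_) u
      · rw [κ_add, κ_add, hα']; grind
      refine additive_ext (φ := fun v => S.κ (stdVec i) v + T.κ (stdVec i) v) (ψ := fun _ => 0)
        (fun x y => ?_) (fun _ _ => (add_zero 0).symm) (fun j => ?_) v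
      · rw [κ_add_right, κ_add_right, hα']; grind
      by_cases hij : i = j
      · subst hij; simp [κ_self]
      · simp only [hκ i j hij]; exact CharTwo.add_self_eq_zero _
    intro u v
    have := h u v
    grind
  refine ⟨fun u => ?_, hκ', hα'⟩
  have h : S.σ u + T.σ u = 0 := by
    refine additive_ext (φ := fun u => S.σ u + T.σ u) (ψ := fun _ => 0)
        (fun x y => ?_) (fun _ _ => (add_zero 0).symm) (fun i => ?_) u
    · rw [σ_add, σ_add, hκ']; grind
    · simp only [hσ i]; exact CharTwo.add_self_eq_zero _
  grind

/-- The coefficient of `uᵢ vⱼ wₗ` in a trilinear form whose cubic form `B u u u` has the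
prescribed coefficients at `uᵢ`, at `uᵢ uⱼ` for `i < j` and at `uᵢ uⱼ uₗ` for `i < j < l`. -/
def sortedCoeff (s : Fin n → ZMod 2) (k : Fin n → Fin n → ZMod 2)
    (a : Fin n → Fin n → Fin n → ZMod 2) (i j l : Fin n) : ZMod 2 :=
  if i < j ∧ j < l then a i j l else if i < j ∧ j = l then k i j
    else if i = j ∧ j = l then s i else 0

/-- The trilinear form with coefficients `b`. -/
noncomputable def trilinearForm (b : Fin n → Fin n → Fin n → ZMod 2) :
    (Fin n → ZMod 2) →ₗ[ZMod 2] (Fin n → ZMod 2) →ₗ[ZMod 2] (Fin n → ZMod 2) →ₗ[ZMod 2] ZMod 2 :=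
  (Pi.basisFun _ _).constr (ZMod 2) fun i => (Pi.basisFun _ _).constr (ZMod 2) fun j =>
    (Pi.basisFun _ _).constr (ZMod 2) fun l => b i j l

theorem trilinearForm_stdVec (b : Fin n → Fin n → Fin n → ZMod 2) (i j l : Fin n) :
    trilinearForm b (stdVec i) (stdVec j) (stdVec l) = b i j l := by
  have h : ∀ i : Fin n, stdVec i = Pi.basisFun (ZMod 2) (Fin n) i := fun i => by simp
  rw [trilinearForm, h, h, h, Module.Basis.constr_basis, Module.Basis.constr_basis,
    Module.Basis.constr_basis]

theorem trilinearForm_apply (b : Fin n → Fin n → Fin n → ZMod 2) (u v w : Fin n → ZMod 2) :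
    trilinearForm b u v w = ∑ i, ∑ j, ∑ l, u i * (v j * (w l * b i j l)) := by
  simp [trilinearForm, Module.Basis.constr_apply_fintype, LinearMap.sum_apply, Finset.mul_sum]

theorem ofTrilinear_sortedCoeff (s : Fin n → ZMod 2) (k : Fin n → Fin n → ZMod 2)
    (a : Fin n → Fin n → Fin n → ZMod 2) (hk : ∀ i j, k i j = k j i)
    (ha : ∀ i j l, a i j l = a j i l) (ha' : ∀ i j l, a i j l = a j l i) :
    let S := ofTrilinear (trilinearForm (sortedCoeff s k a))
    (∀ i, S.σ (stdVec i) = s i) ∧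
      (∀ i j, i ≠ j → S.κ (stdVec i) (stdVec j) = k i j) ∧
      ∀ i j l, i ≠ j → j ≠ l → i ≠ l → S.α ![stdVec i, stdVec j, stdVec l] = a i j l := by
  refine ⟨fun i => ?_, fun i j hij => ?_, fun i j l hij hjl hil => ?_⟩
  · simp [ofTrilinear, trilinearForm_stdVec, sortedCoeff]
  · simp only [ofTrilinear, trilinearForm_stdVec, sortedCoeff]
    rcases lt_or_gt_of_ne hij with h | h
    · simp [h, h.not_gt, h.ne, h.ne']
    · simp [h, h.not_gt, h.ne, h.ne', hk i j]
  · simp only [ofTrilinear, AlternatingMap.ofCyclic_apply, trilinearForm_stdVec, sortedCoeff]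
    have h1 := ha i j l
    have h2 := ha' i j l
    have h3 := ha' j l i
    have h4 := ha' j i l
    have h5 := ha' i l j
    rcases lt_or_gt_of_ne hij with h | h <;> rcases lt_or_gt_of_ne hjl with h' | h' <;>
      rcases lt_or_gt_of_ne hil with h'' | h'' <;>
      simp [h, h.not_gt, h.ne, h.ne', h', h'.not_gt, h'.ne, h'.ne', h'', h''.not_gt, h''.ne,
        h''.ne'] <;> grind

/-- Every symplectic cubic space comes from a trilinear form. -/
theorem exists_ofTrilinear (S : SymplecticCubicSpace (Fin n → ZMod 2)) :
    ∃ B, (∀ u, (ofTrilinear B).σ u = S.σ u) ∧ (∀ u v, (ofTrilinear B).κ u v = S.κ u v) ∧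
      ∀ u v w, (ofTrilinear B).α ![u, v, w] = S.α ![u, v, w] := by
  obtain ⟨h1, h2, h3⟩ := ofTrilinear_sortedCoeff (fun i => S.σ (stdVec i))
    (fun i j => S.κ (stdVec i) (stdVec j)) (fun i j l => S.α ![stdVec i, stdVec j, stdVec l])
    (fun i j => S.κ_comm _ _) (fun i j l => S.α_swap _ _ _) (fun i j l => S.α_cyc _ _ _)
  exact ⟨_, eq_of_stdVec h1 h2 h3⟩

/-- Every symplectic cubic space of dimension `n` with `σ ≠ 0` comes from a code loop. -/
theorem exists_isCodeLoop (S : SymplecticCubicSpace (Fin n → ZMod 2)) (hS : S.σ ≠ 0) :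
    ∃ (L : Type) (_ : MulOneClass L), IsCodeLoop L n ∧ S.IsSpaceOf L := by
  obtain ⟨B, hσ, hκ, hα⟩ := S.exists_ofTrilinear
  obtain ⟨h, hcard⟩ := ofTrilinear_isSpaceOf B (by rwa [funext hσ])
  refine ⟨TwistedLoop (trilinearCochain B), inferInstance, ⟨TwistedLoop.isLoop,
    trilinearCochain_isMoufang B, ?_, hcard⟩, ?_⟩
  · let e : TwistedLoop (trilinearCochain B) ≃ (Fin n → ZMod 2) × ZMod 2 :=
      ⟨fun x => (x.base, x.fib), fun x => ⟨x.1, x.2⟩, fun _ => rfl, fun _ => rfl⟩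
    rw [Nat.card_congr e, Nat.card_prod, Nat.card_fun, Nat.card_zmod, Nat.card_fin, pow_succ]
  · exact h.of_isomorphic ⟨LinearEquiv.refl _ _, hσ, hκ, hα⟩

end SymplecticCubicSpace

/-! ### Normal forms in dimension five -/

namespace SymplecticCubicSpace

/-- The coefficients of a cubic polynomial `σ` in five variables, that is the values of `α`, `κ` and
`σ` on the standard basis. The three numbers list the cubic, the quadratic and the linear
coefficients. The coefficient of a monomial is the binary digit at the position `m = ∑ 2 ^ i`, where
`i` runs over the indices of its variables; such an `m` is called a mask. -/
abbrev Code := ℕ × ℕ × ℕ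

/-- The positions `m < 32` whose own `i`-th binary digit is `1`. -/
def coordMask : ℕ → ℕ
  | 0 => 0xAAAAAAAA
  | 1 => 0xCCCCCCCC
  | 2 => 0xF0F0F0F0
  | 3 => 0xFF00FF00
  | _ => 0xFFFF0000

/-- Moves the coefficient of every monomial that contains the variable `i` but not `j` to the
monomial with `j` in place of `i`. One of the two truncated differences is `0`. -/
def moved (i j x : ℕ) : ℕ :=
  ((x &&& (coordMask i ^^^ (coordMask i &&& coordMask j))) <<< (2 ^ j - 2 ^ i)) >>> (2 ^ i - 2 ^ j)

/-- Moves the coefficient of every monomial that contains the variables `i` and `j` to the monomial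
without `i`. -/
def dropped (i j x : ℕ) : ℕ :=
  (x &&& (coordMask i &&& coordMask j)) >>> 2 ^ i

/-- A product of transvections; `(i, j)` stands for the one that maps `eⱼ` to `eⱼ + eᵢ`. -/
abbrev Word := List (Fin 5 × Fin 5)

/-- The effect of a transvection on the code of a space. -/
def transvectCode (c : Code) (p : Fin 5 × Fin 5) : Code :=
  (c.1 ^^^ moved p.1 p.2 c.1, c.2.1 ^^^ moved p.1 p.2 c.2.1 ^^^ dropped p.1 p.2 c.1,
    c.2.2 ^^^ moved p.1 p.2 c.2.2 ^^^ dropped p.1 p.2 c.2.1)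

/-- The masks of the monomials of degree `d`, for `d = 1, 2, 3`. -/
def masks (d : ℕ) : List ℕ := match d with
  | 1 => [1, 2, 4, 8, 16]
  | 2 => [3, 5, 6, 9, 10, 12, 17, 18, 20, 24]
  | _ => [7, 11, 13, 14, 19, 21, 22, 25, 26, 28]

/-- The number whose digits `1` are at the masks of degree `d`, for `d = 1, 2, 3`. -/
def degreeMask (d : ℕ) : ℕ := match d with
  | 1 => 0x00010116
  | 2 => 0x01161668
  | _ => 0x16686880

/-- The effect of a word on a code, with all digits at other positions than the masks removed. -/
def actCode (w : Word) (c : Code) : Code :=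
  let c' := w.foldl transvectCode c
  (c'.1 &&& degreeMask 3, c'.2.1 &&& degreeMask 2, c'.2.2 &&& degreeMask 1)

/-- Whether `P` holds for all numbers whose digits `1` are at positions in the list. -/
def allSub : List ℕ → (ℕ → Bool) → Bool
  | [], P => P 0
  | m :: ms, P => allSub ms P && allSub ms fun x => P (x ^^^ 2 ^ m)

/-- Words for the reduction of `α`. -/
def wordsα : List Word :=
  [[(1, 0), (0, 1)], [(2, 1), (1, 2)], [(3, 1), (4, 3)], [(3, 2), (2, 3)], [(4, 3), (3, 4)],
   [(2, 0), (3, 1)]]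

/-- Words for the reduction of `κ`. -/
def wordsκ : List Word :=
  [[(4, 1), (1, 2), (2, 0), (3, 4)], [(3, 0), (4, 0)], [(2, 1), (4, 0), (4, 3)],
   [(1, 0), (2, 0), (3, 2), (4, 1)], [(1, 0), (2, 0), (0, 1), (1, 2)],
   [(3, 1), (3, 2), (4, 2), (2, 3)], [(2, 1), (1, 2), (4, 3), (3, 4)],
   [(3, 1), (3, 2), (4, 0), (4, 2)], [(4, 1)], [(2, 0)], [(2, 3), (3, 2)], [(4, 2)],
   [(2, 1), (1, 2)]]

/-- Words for the reduction of `σ`. -/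
def wordsσ : List Word :=
  [[(2, 1), (1, 2), (4, 3), (3, 4)], [(3, 0), (4, 0), (4, 1)],
   [(2, 1), (3, 0), (4, 1), (4, 3), (2, 0)], [(1, 2), (2, 1), (1, 2), (4, 3)],
   [(1, 4), (3, 2), (4, 1), (2, 3), (3, 2), (1, 4)],
   [(0, 1), (1, 0), (3, 4), (4, 3), (3, 4), (0, 1)], [(3, 0), (3, 2)],
   [(1, 0), (3, 1), (4, 2), (4, 3), (2, 1)], [(4, 0), (4, 1), (2, 0)], [(3, 0)],
   [(2, 1), (1, 2), (2, 0)], [(2, 1), (4, 3)], [(2, 0), (3, 1), (4, 2), (3, 2), (2, 0)],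
   [(2, 3), (3, 2), (2, 3)], [(2, 0)], [(3, 1), (4, 1), (2, 0)],
   [(3, 1), (4, 2), (2, 0), (2, 1)], [(2, 3), (1, 2), (3, 4), (1, 4)]]

/-- The normal forms of the pair `(α, κ)`, each with the list of the normal forms of `σ`. Each is the
smallest number in its orbit under the stabilizer of the data before it. -/
def normalForms : List (ℕ × ℕ × List ℕ) :=
  [(128, 0, [0, 2, 6, 256]),
   (128, 104, [0, 22, 256]),
   (128, 512, [0, 4, 256, 258, 65536]),
   (128, 576, [0, 20, 256, 258, 260, 65536]),
   (128, 132096, [0, 16, 256, 260, 272]),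
   (128, 16777216, [0, 2, 6, 65792, 65794, 65798]),
   (128, 16777320, [0, 22, 65792, 65814]),
   (532480, 0, [0, 2, 4, 6]),
   (532480, 64, [0, 2, 20, 22, 256, 258]),
   (532480, 4096, [0, 2, 4, 6, 16, 20, 272, 276]),
   (532480, 4640, [0, 4, 272, 274, 276, 278]),
   (532480, 266240, [0, 2, 4, 272]),
   (532480, 266304, [0, 2, 256, 272]),
   (532480, 266784, [0, 272, 274, 276]),
   (532480, 266816, [0, 256, 258, 272, 274, 65536, 65540]),
   (532480, 1053696, [0, 2, 260, 262])]

/-- The normal forms of `α`: `e₀* ∧ e₁* ∧ e₂*`, and `e₀* ∧ (e₁* ∧ e₄* + e₂* ∧ e₃*)`. -/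
def baseForms : List ℕ := [128, 532480]

/-- Every nonzero `α` that is not in normal form is lowered by one of the words. The quadratic and
linear coefficients have no influence on the result, and zeros stand for them. -/
theorem descent_α : allSub (masks 3) (fun a => a == 0 || baseForms.any (· == a) ||
    wordsα.any fun w => (actCode w (a, 0, 0)).1 != 0 &&
      Nat.blt (actCode w (a, 0, 0)).1 a) = true := by
  decide +kernel

/-- Every `κ` that is not in normal form is lowered by one of the words that fix `α`. -/
theorem descent_κ : (baseForms.all fun a => allSub (masks 2) fun k =>
    normalForms.any (fun f => f.1 == a && f.2.1 == k) ||
    wordsκ.any fun w => (actCode w (a, k, 0)).1 == a &&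
      Nat.blt (actCode w (a, k, 0)).2.1 k) = true := by
  decide +kernel

/-- Every `σ` that is not in normal form is lowered by one of the words that fix `α` and `κ`. -/
theorem descent_σ : (normalForms.all fun f => allSub (masks 1) fun s => f.2.2.any (· == s) ||
    wordsσ.any fun w => (actCode w (f.1, f.2.1, s)).1 == f.1 &&
      (actCode w (f.1, f.2.1, s)).2.1 == f.2.1 && Nat.blt (actCode w (f.1, f.2.1, s)).2.2 s) = true := by
  decide +kernel

/-! ### The invariant of the normal forms -/

/-- All codes in normal form. -/
def normalCodes : List Code :=
  normalForms.flatMap fun f => f.2.2.map fun s => (f.1, f.2.1, s)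

theorem normalCodes_length : normalCodes.length = 80 := by decide +kernel

/-- The sum of `f` over the numbers below `n`, in a form that the kernel evaluates quickly. -/
def sumTo (n : ℕ) (f : ℕ → ℕ) : ℕ := Nat.rec 0 (fun i s => s + f i) n

theorem sumTo_eq (n : ℕ) (f : ℕ → ℕ) : sumTo n f = ∑ i ∈ Finset.range n, f i := by
  induction n with
  | zero => rfl
  | succ n ih => rw [Finset.sum_range_succ, ← ih]; rfl

/-- The coefficient of `uᵢ uⱼ uₗ` in the cubic form given by a code, where only the monomials with
`i < j < l`, `i < j = l` and `i = j = l` are used. -/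
def codeCoeff (c : Code) (i j l : ℕ) : ℕ :=
  bif Nat.blt i j then
    bif Nat.blt j l then (c.1.testBit (2 ^ i + 2 ^ j + 2 ^ l)).toNat
    else bif Nat.beq j l then (c.2.1.testBit (2 ^ i + 2 ^ j)).toNat else 0
  else bif Nat.beq i j && Nat.beq j l then (c.2.2.testBit (2 ^ i)).toNat else 0

/-- A natural number whose parity is the value of `σ` at the vector with the binary digits of `u`. -/
def evalCode (c : Code) (u : ℕ) : ℕ :=
  sumTo 5 fun i => bif u.testBit i then (sumTo 5 fun j => bif u.testBit j then
    (sumTo 5 fun l => bif u.testBit l then codeCoeff c i j l else 0) else 0) else 0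

/-- The truth table of `σ`, with the value at the vector with binary digits `u` as digit `u`. -/
def truthTable (c : Code) : ℕ := Nat.ofBits fun u : Fin 32 => (evalCode c u).testBit 0

/-- The invariant of a space, computed from the truth table of `σ`. -/
def tableInvariant (t : ℕ) : ℕ :=
  sumTo 32 fun u => (sumTo 32 (fun v => (t >>> v % 2) * (t >>> (u ^^^ v) % 2)) + t >>> u % 2) ^ 3

/-- The invariant tells the normal forms apart. -/
theorem tableInvariant_nodup :
    (normalCodes.map fun c => tableInvariant (truthTable c)).Nodup := by
  decide +kernel

/-! ### Codes of symplectic cubic spaces and transvections -/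

/-- The `m`-th binary digit of `x`, as an element of the field with two elements. -/
def bitVal (x m : ℕ) : ZMod 2 := if x.testBit m then 1 else 0

theorem bitVal_xor (x y m : ℕ) : bitVal (x ^^^ y) m = bitVal x m + bitVal y m := by
  have h : (1 : ZMod 2) + 1 = 0 := by decide
  simp only [bitVal, Nat.testBit_xor]
  cases x.testBit m <;> cases y.testBit m <;> simp [h]

theorem bitVal_and (x y m : ℕ) (h : y.testBit m = true) : bitVal (x &&& y) m = bitVal x m := by
  simp [bitVal, Nat.testBit_and, h]

theorem testBit_moved {i j : Fin 5} (hij : i ≠ j) (x : ℕ) {m : ℕ} (hm : m < 32) :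
    (moved i j x).testBit m = (m.testBit j && !m.testBit i &&
      x.testBit (m + 2 ^ i.val - 2 ^ j.val)) := by
  have key : ∀ i j : Fin 5, i ≠ j → ∀ m : Fin 32,
      (decide (2 ^ i.val - 2 ^ j.val + m.val ≥ 2 ^ j.val - 2 ^ i.val) &&
        (coordMask i ^^^ (coordMask i &&& coordMask j)).testBit
          (2 ^ i.val - 2 ^ j.val + m.val - (2 ^ j.val - 2 ^ i.val))) =
        (m.val.testBit j && !m.val.testBit i) ∧
      (m.val.testBit j = true →
        2 ^ i.val - 2 ^ j.val + m.val - (2 ^ j.val - 2 ^ i.val) = m + 2 ^ i.val - 2 ^ j.val) := by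
    decide +kernel
  obtain ⟨h1, h2⟩ := key i j hij ⟨m, hm⟩
  dsimp only at h1 h2
  rw [moved, Nat.testBit_shiftRight, Nat.testBit_shiftLeft, Nat.testBit_and,
    Bool.and_comm (x.testBit _), ← Bool.and_assoc, h1]
  cases h : m.testBit j
  · simp
  · rw [h2 h]

theorem testBit_dropped {i j : Fin 5} (hij : i ≠ j) (x : ℕ) {m : ℕ} (hm : m < 32) :
    (dropped i j x).testBit m = (m.testBit j && !m.testBit i && x.testBit (m + 2 ^ i.val)) := by
  have key : ∀ i j : Fin 5, i ≠ j → ∀ m : Fin 32,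
      (coordMask i &&& coordMask j).testBit (2 ^ i.val + m.val) =
        (m.val.testBit j && !m.val.testBit i) := by
    decide +kernel
  have h1 := key i j hij ⟨m, hm⟩
  dsimp only at h1
  rw [dropped, Nat.testBit_shiftRight, Nat.testBit_and, h1, Bool.and_comm, add_comm m]

theorem bitVal_moved {i j : Fin 5} (hij : i ≠ j) (x : ℕ) {m : ℕ} (hm : m < 32) :
    bitVal (moved i j x) m =
      if m.testBit j ∧ ¬ m.testBit i then bitVal x (m + 2 ^ i.val - 2 ^ j.val) else 0 := by
  simp only [bitVal, testBit_moved hij x hm]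
  cases m.testBit j <;> cases m.testBit i <;> simp

theorem bitVal_dropped {i j : Fin 5} (hij : i ≠ j) (x : ℕ) {m : ℕ} (hm : m < 32) :
    bitVal (dropped i j x) m =
      if m.testBit j ∧ ¬ m.testBit i then bitVal x (m + 2 ^ i.val) else 0 := by
  simp only [bitVal, testBit_dropped hij x hm]
  cases m.testBit j <;> cases m.testBit i <;> simp

theorem testBit_mono₁ : ∀ p t : Fin 5, (2 ^ p.val).testBit t = decide (t = p) := by
  decide +kernel

theorem testBit_mono₂ : ∀ p q t : Fin 5, p ≠ q →
    (2 ^ p.val + 2 ^ q.val).testBit t = decide (t = p ∨ t = q) := by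
  decide +kernel

theorem testBit_mono₃ : ∀ p q r t : Fin 5, p ≠ q → q ≠ r → p ≠ r →
    (2 ^ p.val + 2 ^ q.val + 2 ^ r.val).testBit t = decide (t = p ∨ t = q ∨ t = r) := by
  decide +kernel

theorem mono_lt : (∀ p : Fin 5, 2 ^ p.val < 32) ∧
    (∀ p q : Fin 5, p ≠ q → 2 ^ p.val + 2 ^ q.val < 32) ∧
    ∀ p q r : Fin 5, p ≠ q → q ≠ r → p ≠ r → 2 ^ p.val + 2 ^ q.val + 2 ^ r.val < 32 := by
  decide +kernel

/-- `c` lists the values of `S` on the standard basis. -/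
structure HasCode (S : SymplecticCubicSpace (Fin 5 → ZMod 2)) (c : Code) : Prop where
  σ : ∀ p, S.σ (stdVec p) = bitVal c.2.2 (2 ^ p.val)
  κ : ∀ p q, p ≠ q → S.κ (stdVec p) (stdVec q) = bitVal c.2.1 (2 ^ p.val + 2 ^ q.val)
  α : ∀ p q r, p ≠ q → q ≠ r → p ≠ r → S.α ![stdVec p, stdVec q, stdVec r] =
    bitVal c.1 (2 ^ p.val + 2 ^ q.val + 2 ^ r.val)

/-- Binary digits below `32` can be prescribed. -/
theorem exists_bitVal (P : ℕ → Prop) : ∃ x : ℕ, ∀ m < 32, x.testBit m = true ↔ P m := by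
  classical
  exact ⟨Nat.ofBits fun m : Fin 32 => decide (P m), fun m hm => by
    rw [Nat.testBit_ofBits_lt _ _ hm, decide_eq_true_iff]⟩

theorem eq_bitVal {t : ZMod 2} {x m : ℕ} (h : x.testBit m = true ↔ t = 1) : t = bitVal x m := by
  have ht : ∀ t : ZMod 2, t = 0 ∨ t = 1 := by decide
  rw [bitVal]
  rcases ht t with rfl | rfl
  · simpa using h
  · simpa using h

theorem exists_hasCode (S : SymplecticCubicSpace (Fin 5 → ZMod 2)) : ∃ c, S.HasCode c := by
  obtain ⟨s, hs⟩ := exists_bitVal fun m => ∃ p : Fin 5, m = 2 ^ p.val ∧ S.σ (stdVec p) = 1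
  obtain ⟨k, hk⟩ := exists_bitVal fun m => ∃ p q : Fin 5, p ≠ q ∧ m = 2 ^ p.val + 2 ^ q.val ∧
    S.κ (stdVec p) (stdVec q) = 1
  obtain ⟨a, ha⟩ := exists_bitVal fun m => ∃ p q r : Fin 5, p ≠ q ∧ q ≠ r ∧ p ≠ r ∧
    m = 2 ^ p.val + 2 ^ q.val + 2 ^ r.val ∧ S.α ![stdVec p, stdVec q, stdVec r] = 1
  refine ⟨(a, k, s), fun p => eq_bitVal ?_, fun p q h => eq_bitVal ?_,
    fun p q r hpq hqr hpr => eq_bitVal ?_⟩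
  · rw [hs _ (mono_lt.1 p)]
    refine ⟨?_, fun h => ⟨p, rfl, h⟩⟩
    rintro ⟨p', hp, h⟩
    have h1 := testBit_mono₁ p' p'
    rw [← hp, testBit_mono₁] at h1
    obtain rfl : p' = p := by simpa using h1
    exact h
  · rw [hk _ (mono_lt.2.1 p q h)]
    refine ⟨?_, fun h' => ⟨p, q, h, rfl, h'⟩⟩
    rintro ⟨p', q', hne, hp, h'⟩
    have h1 := testBit_mono₂ p' q' p' hne
    have h2 := testBit_mono₂ p' q' q' hne
    rw [← hp, testBit_mono₂ _ _ _ h] at h1 h2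
    simp only [true_or, or_true, decide_true, decide_eq_true_eq] at h1 h2
    rcases h1 with rfl | rfl <;> rcases h2 with rfl | rfl <;>
      first | exact absurd rfl hne | exact h' | (rw [κ_comm]; exact h')
  · rw [ha _ (mono_lt.2.2 p q r hpq hqr hpr)]
    refine ⟨?_, fun h' => ⟨p, q, r, hpq, hqr, hpr, rfl, h'⟩⟩
    rintro ⟨p', q', r', hpq', hqr', hpr', hp, h'⟩
    have h1 := testBit_mono₃ p' q' r' p' hpq' hqr' hpr'
    have h2 := testBit_mono₃ p' q' r' q' hpq' hqr' hpr'
    have h3 := testBit_mono₃ p' q' r' r' hpq' hqr' hpr'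
    rw [← hp, testBit_mono₃ _ _ _ _ hpq hqr hpr] at h1 h2 h3
    simp only [true_or, or_true, decide_true, decide_eq_true_eq] at h1 h2 h3
    rcases h1 with rfl | rfl | rfl <;> rcases h2 with rfl | rfl | rfl <;>
      first
      | exact absurd rfl hpq'
      | rcases h3 with rfl | rfl | rfl <;>
        first
        | exact absurd rfl hqr'
        | exact absurd rfl hpr'
        | exact h'
        | (rw [α_swap]; exact h')
        | (rw [α_cyc]; exact h')
        | (rw [← α_cyc]; exact h')
        | (rw [α_swap, α_cyc]; exact h')
        | (rw [α_swap, ← α_cyc]; exact h')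

/-- The pullback of a symplectic cubic space under a linear map. -/
def comap {V W : Type*} [AddCommGroup V] [Module (ZMod 2) V] [AddCommGroup W] [Module (ZMod 2) W]
    (S : SymplecticCubicSpace W) (A : V →ₗ[ZMod 2] W) : SymplecticCubicSpace V where
  σ u := S.σ (A u)
  κ u v := S.κ (A u) (A v)
  α := S.α.compLinearMap A
  κ_self u := S.κ_self _
  σ_add u v := by rw [map_add, S.σ_add]
  κ_add u v w := by
    rw [map_add, S.κ_add, AlternatingMap.compLinearMap_apply]
    congr 2
    ext i
    fin_cases i <;> rfl

theorem comap_α {V W : Type*} [AddCommGroup V] [Module (ZMod 2) V] [AddCommGroup W]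
    [Module (ZMod 2) W] (S : SymplecticCubicSpace W) (A : V →ₗ[ZMod 2] W) (u v w : V) :
    (S.comap A).α ![u, v, w] = S.α ![A u, A v, A w] := by
  rw [comap, AlternatingMap.compLinearMap_apply]
  congr 1
  ext i
  fin_cases i <;> rfl

theorem comap_isomorphic {V W : Type*} [AddCommGroup V] [Module (ZMod 2) V] [AddCommGroup W]
    [Module (ZMod 2) W] (S : SymplecticCubicSpace W) (A : V ≃ₗ[ZMod 2] W) :
    (S.comap A.toLinearMap).Isomorphic S :=
  ⟨A, fun _ => rfl, fun _ _ => rfl, fun u v w => (S.comap_α A.toLinearMap u v w).symm⟩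

/-- The transvection that maps the basis vector `eⱼ` to `eⱼ + eᵢ` and fixes the others. -/
def shear {n : ℕ} (i j : Fin n) (hij : i ≠ j) : (Fin n → ZMod 2) ≃ₗ[ZMod 2] (Fin n → ZMod 2) :=
  LinearEquiv.ofInvolutive
    (LinearMap.id + (LinearMap.proj j : (Fin n → ZMod 2) →ₗ[ZMod 2] ZMod 2).smulRight (stdVec i))
    fun u => by
      have h : ∀ v : Fin n → ZMod 2, v + v = 0 := ZModModule.add_self
      simp [hij.symm, add_assoc, h]

theorem shear_self {n : ℕ} {i j : Fin n} (hij : i ≠ j) :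
    shear i j hij (stdVec j) = stdVec j + stdVec i := by
  change stdVec j + (stdVec j : Fin n → ZMod 2) j • (stdVec i : Fin n → ZMod 2) = _
  simp

theorem shear_of_ne {n : ℕ} {i j p : Fin n} (hij : i ≠ j) (hp : p ≠ j) :
    shear i j hij (stdVec p) = stdVec p := by
  change stdVec p + (stdVec p : Fin n → ZMod 2) j • (stdVec i : Fin n → ZMod 2) = _
  simp [hp.symm]

/-- Transvections act on codes by `transvectCode`: the values on the basis change by those with `i` in
place of `j`, and by those with both. -/
theorem HasCode.transvect {S : SymplecticCubicSpace (Fin 5 → ZMod 2)} {c : Code} (h : S.HasCode c)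
    {i j : Fin 5} (hij : i ≠ j) :
    (S.comap (shear i j hij).toLinearMap).HasCode (transvectCode c (i, j)) := by
  have e1 : shear i j hij (stdVec j) = stdVec j + stdVec i := shear_self hij
  have e2 : ∀ p, p ≠ j → shear i j hij (stdVec p) = stdVec p := fun p hp => shear_of_ne hij hp
  -- it suffices to treat the case where `eⱼ` is the first argument
  have hκj : ∀ q, q ≠ j → S.κ (stdVec j + stdVec i) (stdVec q) =
      bitVal (transvectCode c (i, j)).2.1 (2 ^ j.val + 2 ^ q.val) := by
    intro q hq
    have hm := mono_lt.2.1 j q hq.symm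
    simp only [transvectCode, bitVal_xor, bitVal_moved hij _ hm,
      bitVal_dropped hij _ hm, testBit_mono₂ j q _ hq.symm, S.κ_add]
    by_cases hqi : q = i
    · subst hqi
      have h1 : S.α ![stdVec j, stdVec q, stdVec q] = 0 := by rw [α_cyc, α_self]
      simp [h.κ j q hq.symm, κ_self, h1]
    · have h1 : 2 ^ j.val + 2 ^ q.val + 2 ^ i.val - 2 ^ j.val = 2 ^ i.val + 2 ^ q.val := by
        rw [add_assoc, Nat.add_sub_cancel_left, add_comm]
      have h2 : 2 ^ j.val + 2 ^ q.val + 2 ^ i.val = 2 ^ j.val + 2 ^ i.val + 2 ^ q.val :=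
        add_right_comm _ _ _
      simp only [h1, h.κ j q hq.symm, h.κ i q (Ne.symm hqi),
        h.α j i q hij.symm (Ne.symm hqi) hq.symm]
      simp [h2, hij, Ne.symm hqi]
  have hαj : ∀ q r, q ≠ j → r ≠ j → q ≠ r → S.α ![stdVec j + stdVec i, stdVec q, stdVec r] =
      bitVal (transvectCode c (i, j)).1 (2 ^ j.val + 2 ^ q.val + 2 ^ r.val) := by
    intro q r hq hr hqr
    have hm := mono_lt.2.2 j q r hq.symm hqr hr.symm
    simp only [transvectCode, bitVal_xor, bitVal_moved hij _ hm,
      testBit_mono₃ j q r _ hq.symm hqr hr.symm, S.α_add, h.α j q r hq.symm hqr hr.symm]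
    by_cases hqi : q = i
    · subst hqi
      simp [α_self]
    by_cases hri : r = i
    · subst hri
      have h1 : S.α ![stdVec r, stdVec q, stdVec r] = 0 := by rw [← α_cyc, α_self]
      simp [h1]
    · have h1 : 2 ^ j.val + 2 ^ q.val + 2 ^ r.val + 2 ^ i.val - 2 ^ j.val =
          2 ^ i.val + 2 ^ q.val + 2 ^ r.val := by
        rw [add_assoc, add_assoc, Nat.add_sub_cancel_left, ← add_assoc, add_comm, ← add_assoc]
      simp only [h1, h.α i q r (Ne.symm hqi) hqr (Ne.symm hri)]
      simp [hij, Ne.symm hqi, Ne.symm hri]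
  refine ⟨fun p => ?_, fun p q hpq => ?_, fun p q r hpq hqr hpr => ?_⟩
  · change S.σ (shear i j hij (stdVec p)) = _
    have hm := mono_lt.1 p
    simp only [transvectCode, bitVal_xor, bitVal_moved hij _ hm,
      bitVal_dropped hij _ hm, testBit_mono₁ p]
    by_cases hp : p = j
    · subst hp
      have h1 : 2 ^ p.val + 2 ^ i.val - 2 ^ p.val = 2 ^ i.val := Nat.add_sub_cancel_left _ _
      simp only [e1, h1, S.σ_add, h.σ, h.κ p i hij.symm]
      simp [hij]
    · simp [e2 p hp, h.σ, Ne.symm hp]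
  · change S.κ (shear i j hij (stdVec p)) (shear i j hij (stdVec q)) = _
    by_cases hp : p = j
    · subst hp
      rw [e1, e2 q hpq.symm, hκj q hpq.symm]
    by_cases hq : q = j
    · subst hq
      rw [e1, e2 p hpq, κ_comm, hκj p hpq, add_comm]
    have hm := mono_lt.2.1 p q hpq
    rw [e2 p hp, e2 q hq, h.κ p q hpq]
    simp only [transvectCode, bitVal_xor, bitVal_moved hij _ hm,
      bitVal_dropped hij _ hm, testBit_mono₂ p q _ hpq]
    simp [Ne.symm hp, Ne.symm hq]
  · rw [comap_α]
    change S.α ![shear i j hij (stdVec p), shear i j hij (stdVec q), shear i j hij (stdVec r)] = _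
    by_cases hp : p = j
    · subst hp
      rw [e1, e2 q hpq.symm, e2 r hpr.symm, hαj q r hpq.symm hpr.symm hqr]
    by_cases hq : q = j
    · subst hq
      rw [e1, e2 p hpq, e2 r hqr.symm, α_cyc, hαj r p hqr.symm hpq hpr.symm,
        add_rotate (2 ^ p.val)]
    by_cases hr : r = j
    · subst hr
      rw [e1, e2 p hpr, e2 q hqr, ← α_cyc, hαj p q hpr hqr hpq, add_assoc, add_comm]
    have hm := mono_lt.2.2 p q r hpq hqr hpr
    rw [e2 p hp, e2 q hq, e2 r hr, h.α p q r hpq hqr hpr]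
    simp only [transvectCode, bitVal_xor, bitVal_moved hij _ hm,
      testBit_mono₃ p q r _ hpq hqr hpr]
    simp [Ne.symm hp, Ne.symm hq, Ne.symm hr]

theorem Isomorphic.refl {V : Type*} [AddCommGroup V] [Module (ZMod 2) V]
    (S : SymplecticCubicSpace V) : S.Isomorphic S :=
  ⟨LinearEquiv.refl _ _, fun _ => rfl, fun _ _ => rfl, fun _ _ _ => rfl⟩

theorem HasCode.foldl {S : SymplecticCubicSpace (Fin 5 → ZMod 2)} (w : Word)
    (hw : ∀ p ∈ w, p.1 ≠ p.2) {c : Code} (h : S.HasCode c) :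
    ∃ T : SymplecticCubicSpace (Fin 5 → ZMod 2), T.Isomorphic S ∧
      T.HasCode (w.foldl transvectCode c) := by
  induction w generalizing S c with
  | nil => exact ⟨S, .refl S, h⟩
  | cons p w ih =>
    obtain ⟨T, hT, hc⟩ := ih (fun q hq => hw q (List.mem_cons_of_mem _ hq))
      (h.transvect (hw p List.mem_cons_self))
    exact ⟨T, hT.trans (comap_isomorphic _ _), hc⟩

theorem HasCode.degreeMask_one {S : SymplecticCubicSpace (Fin 5 → ZMod 2)} {a k s : ℕ}
    (h : S.HasCode (a, k, s)) : S.HasCode (a, k, s &&& degreeMask 1) := by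
  have h1 : ∀ p : Fin 5, (degreeMask 1).testBit (2 ^ p.val) = true := by
    decide +kernel
  exact ⟨fun p => by rw [bitVal_and _ _ _ (h1 p), h.σ], h.κ, h.α⟩

theorem HasCode.degreeMask_two {S : SymplecticCubicSpace (Fin 5 → ZMod 2)} {a k s : ℕ}
    (h : S.HasCode (a, k, s)) : S.HasCode (a, k &&& degreeMask 2, s) := by
  have h1 : ∀ p q : Fin 5, p ≠ q → (degreeMask 2).testBit (2 ^ p.val + 2 ^ q.val) = true := by
    decide +kernel
  exact ⟨h.σ, fun p q hpq => by rw [bitVal_and _ _ _ (h1 p q hpq), h.κ p q hpq], h.α⟩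

theorem HasCode.degreeMask_three {S : SymplecticCubicSpace (Fin 5 → ZMod 2)} {a k s : ℕ}
    (h : S.HasCode (a, k, s)) : S.HasCode (a &&& degreeMask 3, k, s) := by
  have h1 : ∀ p q r : Fin 5, p ≠ q → q ≠ r → p ≠ r →
      (degreeMask 3).testBit (2 ^ p.val + 2 ^ q.val + 2 ^ r.val) = true := by
    decide +kernel
  exact ⟨h.σ, h.κ, fun p q r hpq hqr hpr => by
    rw [bitVal_and _ _ _ (h1 p q r hpq hqr hpr), h.α p q r hpq hqr hpr]⟩

theorem HasCode.act {S : SymplecticCubicSpace (Fin 5 → ZMod 2)} (w : Word)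
    (hw : ∀ p ∈ w, p.1 ≠ p.2) {c : Code} (h : S.HasCode c) :
    ∃ T : SymplecticCubicSpace (Fin 5 → ZMod 2), T.Isomorphic S ∧ T.HasCode (actCode w c) := by
  obtain ⟨T, hT, hc⟩ := h.foldl w hw
  exact ⟨T, hT, hc.degreeMask_three.degreeMask_two.degreeMask_one⟩

/-- The action on the cubic part depends only on the cubic part. -/
theorem actCode_fst_congr (w : Word) {c d : Code} (h : c.1 = d.1) :
    (actCode w c).1 = (actCode w d).1 := by
  suffices (w.foldl transvectCode c).1 = (w.foldl transvectCode d).1 by simp only [actCode, this]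
  induction w generalizing c d with
  | nil => exact h
  | cons p w ih => exact ih (by simp only [transvectCode, h])

/-- The action on the quadratic part depends only on the cubic and the quadratic part. -/
theorem actCode_snd_congr (w : Word) {c d : Code} (h : c.1 = d.1) (h' : c.2.1 = d.2.1) :
    (actCode w c).2.1 = (actCode w d).2.1 := by
  suffices (w.foldl transvectCode c).2.1 = (w.foldl transvectCode d).2.1 by
    simp only [actCode, this]
  induction w generalizing c d with
  | nil => exact h'
  | cons p w ih => exact ih (by simp only [transvectCode, h]) (by simp only [transvectCode, h, h'])

theorem allSub_spec (ms : List ℕ) (P : ℕ → Bool) (h : allSub ms P = true) (x : ℕ)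
    (hx : ∀ m, x.testBit m = true → m ∈ ms) : P x = true := by
  induction ms generalizing P x with
  | nil =>
    obtain rfl : x = 0 := Nat.eq_of_testBit_eq fun m => by
      have := hx m
      simpa using this
    exact h
  | cons m ms ih =>
    rw [allSub, Bool.and_eq_true] at h
    by_cases hm : m ∈ ms
    · exact ih P h.1 x fun l hl => by
        rcases List.mem_cons.1 (hx l hl) with rfl | h'
        exacts [hm, h']
    cases hxm : x.testBit m
    · refine ih P h.1 x fun l hl => ?_
      rcases List.mem_cons.1 (hx l hl) with rfl | h'
      · rw [hxm] at hl; exact absurd hl (by decide)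
      · exact h'
    · have := ih _ h.2 (x ^^^ 2 ^ m) fun l hl => by
        rw [Nat.testBit_xor, Nat.testBit_two_pow] at hl
        by_cases hlm : m = l
        · subst hlm; simp [hxm] at hl
        · have := hx l (by simpa [hlm] using hl)
          rcases List.mem_cons.1 this with rfl | h'
          · exact absurd rfl hlm
          · exact h'
      simpa [Nat.xor_assoc] using this

theorem mem_masks (d : ℕ) {x m : ℕ} (h : (x &&& degreeMask d).testBit m = true) : m ∈ masks d := by
  have h1 : (degreeMask d).testBit m = true := by
    rw [Nat.testBit_and, Bool.and_eq_true] at h; exact h.2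
  have h2 : degreeMask d < 2 ^ 32 := by
    unfold degreeMask; split <;> norm_num
  have h3 : m < 32 := by
    by_contra hm
    rw [Nat.testBit_lt_two_pow
      (h2.trans_le (Nat.pow_le_pow_right (by norm_num) (not_lt.1 hm)))] at h1
    exact absurd h1 (by decide)
  have h4 : ∀ m < 32, ((degreeMask 1).testBit m = true → m ∈ masks 1) ∧
      ((degreeMask 2).testBit m = true → m ∈ masks 2) ∧
      ((degreeMask 3).testBit m = true → m ∈ masks 3) := by
    decide +kernel
  match d with
  | 1 => exact (h4 m h3).1 h1
  | 2 => exact (h4 m h3).2.1 h1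
  | 0 => exact (h4 m h3).2.2 h1
  | _ + 3 => exact (h4 m h3).2.2 h1

/-! ### Classification in dimension five -/

theorem words_valid : ∀ w ∈ wordsα ++ wordsκ ++ wordsσ, ∀ p ∈ w, p.1 ≠ p.2 := by
  decide +kernel

/-- The form `α` can be brought into one of the two nonzero normal forms. -/
theorem exists_normalForm_α (a : ℕ) : ∀ (k s : ℕ) (S : SymplecticCubicSpace (Fin 5 → ZMod 2)),
    S.HasCode (a, k, s) → a &&& degreeMask 3 = a → a ≠ 0 →
    ∃ a' ∈ baseForms, ∃ (k s : ℕ) (T : SymplecticCubicSpace (Fin 5 → ZMod 2)),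
      T.Isomorphic S ∧ T.HasCode (a', k, s) := by
  induction a using Nat.strong_induction_on with
  | _ a ih =>
  intro k s S h ha ha0
  have hc := allSub_spec _ _ descent_α a fun m hm => mem_masks 3 (by rwa [ha])
  simp only [Bool.or_eq_true, beq_iff_eq, List.any_eq_true, Bool.and_eq_true, bne_iff_ne,
    Nat.blt_eq] at hc
  rcases hc with (hc | ⟨b, hb, rfl⟩) | ⟨w, hw, hne, hlt⟩
  · exact absurd hc ha0
  · exact ⟨b, hb, k, s, S, .refl S, h⟩
  · obtain ⟨T, hT, hTc⟩ := h.act w (words_valid w (by simp [hw]))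
    rw [actCode_fst_congr w (c := (a, 0, 0)) (d := (a, k, s)) rfl] at hne hlt
    obtain ⟨a', ha', k', s', T', hT', hc'⟩ := ih _ hlt _ _ T hTc
      (by simp only [actCode, Nat.and_assoc, Nat.and_self]) hne
    exact ⟨a', ha', k', s', T', hT'.trans hT, hc'⟩

/-- For a fixed normal form of `α`, the form `κ` can be brought into normal form. -/
theorem exists_normalForm_κ {a : ℕ} (ha : a ∈ baseForms) (k : ℕ) :
    ∀ (s : ℕ) (S : SymplecticCubicSpace (Fin 5 → ZMod 2)),
    S.HasCode (a, k, s) → k &&& degreeMask 2 = k →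
    ∃ f ∈ normalForms, ∃ (s : ℕ) (T : SymplecticCubicSpace (Fin 5 → ZMod 2)),
      T.Isomorphic S ∧ T.HasCode (f.1, f.2.1, s) := by
  induction k using Nat.strong_induction_on with
  | _ k ih =>
  intro s S h hk
  have hc := allSub_spec _ _ (List.all_eq_true.1 descent_κ a ha) k fun m hm =>
    mem_masks 2 (by rwa [hk])
  simp only [Bool.or_eq_true, beq_iff_eq, List.any_eq_true, Bool.and_eq_true, Nat.blt_eq] at hc
  rcases hc with ⟨f, hf, hfa, hfk⟩ | ⟨w, hw, heq, hlt⟩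
  · subst hfa hfk
    exact ⟨f, hf, s, S, .refl S, h⟩
  · obtain ⟨T, hT, hTc⟩ := h.act w (words_valid w (by simp [hw]))
    rw [actCode_fst_congr w (c := (a, k, 0)) (d := (a, k, s)) rfl] at heq
    rw [actCode_snd_congr w (c := (a, k, 0)) (d := (a, k, s)) rfl rfl] at hlt
    have h1 : actCode w (a, k, s) = (a, (actCode w (a, k, s)).2.1, (actCode w (a, k, s)).2.2) :=
      Prod.ext heq rfl
    rw [h1] at hTc
    obtain ⟨f, hf, s', T', hT', hc'⟩ := ih _ hlt _ T hTc
      (by simp only [actCode, Nat.and_assoc, Nat.and_self])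
    exact ⟨f, hf, s', T', hT'.trans hT, hc'⟩

/-- For fixed normal forms of `α` and `κ`, the form `σ` can be brought into normal form. -/
theorem exists_normalForm_σ {f : ℕ × ℕ × List ℕ} (hf : f ∈ normalForms) (s : ℕ) :
    ∀ S : SymplecticCubicSpace (Fin 5 → ZMod 2),
    S.HasCode (f.1, f.2.1, s) → s &&& degreeMask 1 = s →
    ∃ s ∈ f.2.2, ∃ T : SymplecticCubicSpace (Fin 5 → ZMod 2),
      T.Isomorphic S ∧ T.HasCode (f.1, f.2.1, s) := by
  induction s using Nat.strong_induction_on with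
  | _ s ih =>
  intro S h hs
  have hc := allSub_spec _ _ (List.all_eq_true.1 descent_σ f hf) s fun m hm =>
    mem_masks 1 (by rwa [hs])
  simp only [Bool.or_eq_true, beq_iff_eq, List.any_eq_true, Bool.and_eq_true, Nat.blt_eq] at hc
  rcases hc with ⟨s', hs', rfl⟩ | ⟨w, hw, ⟨heq, heq'⟩, hlt⟩
  · exact ⟨s', hs', S, .refl S, h⟩
  · obtain ⟨T, hT, hTc⟩ := h.act w (words_valid w (by simp [hw]))
    have h1 : actCode w (f.1, f.2.1, s) = (f.1, f.2.1, (actCode w (f.1, f.2.1, s)).2.2) :=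
      Prod.ext heq (Prod.ext heq' rfl)
    rw [h1] at hTc
    obtain ⟨s', hs', T', hT', hc'⟩ := ih _ hlt T hTc
      (by simp only [actCode, Nat.and_assoc, Nat.and_self])
    exact ⟨s', hs', T', hT'.trans hT, hc'⟩

/-- The coefficients listed by a code, as those of a trilinear form. -/
def codeForm (c : Code) : Fin 5 → Fin 5 → Fin 5 → ZMod 2 :=
  sortedCoeff (fun p => bitVal c.2.2 (2 ^ p.val))
    (fun p q => bitVal c.2.1 (2 ^ p.val + 2 ^ q.val))
    (fun p q r => bitVal c.1 (2 ^ p.val + 2 ^ q.val + 2 ^ r.val))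

/-- The symplectic cubic space with a given code. -/
noncomputable def codeSpace (c : Code) : SymplecticCubicSpace (Fin 5 → ZMod 2) :=
  ofTrilinear (trilinearForm (codeForm c))

theorem codeSpace_hasCode (c : Code) : (codeSpace c).HasCode c := by
  obtain ⟨h1, h2, h3⟩ := ofTrilinear_sortedCoeff (fun p : Fin 5 => bitVal c.2.2 (2 ^ p.val))
    (fun p q => bitVal c.2.1 (2 ^ p.val + 2 ^ q.val))
    (fun p q r => bitVal c.1 (2 ^ p.val + 2 ^ q.val + 2 ^ r.val))
    (fun p q => by rw [add_comm]) (fun p q r => by rw [add_comm (2 ^ p.val)])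
    (fun p q r => by rw [add_rotate])
  exact ⟨h1, h2, h3⟩

theorem HasCode.isomorphic {S T : SymplecticCubicSpace (Fin 5 → ZMod 2)} {c : Code}
    (hS : S.HasCode c) (hT : T.HasCode c) : S.Isomorphic T := by
  obtain ⟨h1, h2, h3⟩ := eq_of_stdVec (S := T) (T := S) (fun p => by rw [hT.σ, hS.σ])
    (fun p q h => by rw [hT.κ p q h, hS.κ p q h])
    (fun p q r h h' h'' => by rw [hT.α p q r h h' h'', hS.α p q r h h' h''])
  exact ⟨LinearEquiv.refl _ _, h1, h2, h3⟩

/-- Every space of dimension five with `α ≠ 0` is isomorphic to one in normal form. -/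
theorem exists_normalCode (S : SymplecticCubicSpace (Fin 5 → ZMod 2))
    (hS : ∃ u v w, S.α ![u, v, w] ≠ 0) : ∃ c ∈ normalCodes, S.Isomorphic (codeSpace c) := by
  obtain ⟨⟨a, k, s⟩, h⟩ := S.exists_hasCode
  have h₁ := h.degreeMask_three
  have ha0 : a &&& degreeMask 3 ≠ 0 := by
    intro h0
    rw [h0] at h₁
    obtain ⟨u, v, w, huvw⟩ := hS
    refine huvw ((α_eq_of_stdVec (S := S) (T := ofTrilinear 0) (fun p q r h h' h'' => ?_)
      u v w).trans ?_)
    · rw [h₁.α p q r h h' h'']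
      simp [bitVal, ofTrilinear]
    · simp [ofTrilinear]
  obtain ⟨a', ha', k', s', T₁, hT₁, hc₁⟩ := exists_normalForm_α _ _ _ S h₁
    (by rw [Nat.and_assoc, Nat.and_self]) ha0
  obtain ⟨f, hf, s'', T₂, hT₂, hc₂⟩ := exists_normalForm_κ ha' _ _ T₁ hc₁.degreeMask_two
    (by rw [Nat.and_assoc, Nat.and_self])
  obtain ⟨t, ht, T₃, hT₃, hc₃⟩ := exists_normalForm_σ hf _ T₂ hc₂.degreeMask_one
    (by rw [Nat.and_assoc, Nat.and_self])
  refine ⟨(f.1, f.2.1, t), ?_, ?_⟩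
  · rw [normalCodes, List.mem_flatMap]
    exact ⟨f, hf, List.mem_map_of_mem ht⟩
  · exact ((hT₃.trans hT₂).trans hT₁).symm.trans (hc₃.isomorphic (codeSpace_hasCode _))

/-- An isomorphism invariant: the sum over all `u` of the cube of
`#{v | σ v = σ (u + v) = 1} + σ u`. -/
def invariant (S : SymplecticCubicSpace (Fin 5 → ZMod 2)) : ℕ :=
  ∑ u, ((∑ v, (S.σ v).val * (S.σ (u + v)).val) + (S.σ u).val) ^ 3

theorem Isomorphic.invariant_eq {S T : SymplecticCubicSpace (Fin 5 → ZMod 2)}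
    (h : S.Isomorphic T) : S.invariant = T.invariant := by
  obtain ⟨A, hσ, -, -⟩ := h
  have hn : ∀ u, ∑ v, (S.σ v).val * (S.σ (u + v)).val =
      ∑ v, (T.σ v).val * (T.σ (A u + v)).val := fun u =>
    Fintype.sum_equiv A.toEquiv _ _ fun v => by
      rw [LinearEquiv.coe_toEquiv, ← map_add, hσ, hσ]
  exact Fintype.sum_equiv A.toEquiv _ _ fun u => by
    rw [LinearEquiv.coe_toEquiv, hn, hσ]

/-- The vector whose coordinates are the binary digits of `m`. -/
def bitVec (m : ℕ) : Fin 5 → ZMod 2 := fun i => bitVal m i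

theorem bitVec_xor (m l : ℕ) : bitVec (m ^^^ l) = bitVec m + bitVec l :=
  funext fun _ => bitVal_xor _ _ _

theorem bitVec_bijective : Function.Bijective fun m : Fin 32 => bitVec m := by
  rw [Fintype.bijective_iff_injective_and_card]
  refine ⟨fun m l h => ?_, by simp⟩
  refine Fin.ext (Nat.eq_of_testBit_eq fun i => ?_)
  by_cases hi : i < 5
  · have h1 : bitVal m i = bitVal l i := congrFun h ⟨i, hi⟩
    simp only [bitVal] at h1
    cases hm : m.val.testBit i <;> cases hl : l.val.testBit i <;> simp [hm, hl] at h1 ⊢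
  · have h32 : ∀ m : Fin 32, m.val < 2 ^ i := fun m =>
      m.2.trans_le (Nat.pow_le_pow_right (n := 2) (by norm_num) (not_lt.1 hi))
    rw [Nat.testBit_lt_two_pow (h32 m), Nat.testBit_lt_two_pow (h32 l)]

theorem sum_bitVec (F : (Fin 5 → ZMod 2) → ℕ) : ∑ u, F u = sumTo 32 fun m => F (bitVec m) := by
  rw [sumTo_eq, ← bitVec_bijective.sum_comp, Fin.sum_univ_eq_sum_range (fun m => F (bitVec m))]

theorem codeCoeff_cast (c : Code) (i j l : Fin 5) :
    (codeCoeff c i j l : ZMod 2) = codeForm c i j l := by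
  have hb : ∀ x m : ℕ, (((x.testBit m).toNat : ℕ) : ZMod 2) = bitVal x m := fun x m => by
    rw [bitVal]; cases x.testBit m <;> simp
  have hblt : ∀ i j : Fin 5, Nat.blt i j = decide (i < j) := by decide
  have hbeq : ∀ i j : Fin 5, Nat.beq i j = decide (i = j) := by decide
  simp only [codeCoeff, codeForm, sortedCoeff, hblt, hbeq]
  by_cases h1 : i < j
  · by_cases h2 : j < l
    · simp [h1, h2, hb]
    · by_cases h3 : j = l
      · subst h3; simp [h1, hb]
      · simp [h1, h2, h3]
  · by_cases h2 : i = j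
    · by_cases h3 : j = l
      · subst h2 h3; simp [hb]
      · simp [h2, h3]
    · simp [h1, h2]

theorem evalCode_cast (c : Code) (m : ℕ) :
    (evalCode c m : ZMod 2) = (codeSpace c).σ (bitVec m) := by
  have hb : ∀ (i : Fin 5) (x : ℕ), ((bif m.testBit i then x else 0 : ℕ) : ZMod 2) =
      bitVec m i * x := fun i x => by
    rw [bitVec, bitVal]; cases m.testBit i <;> simp
  have hsum : ∀ g : ℕ → ℕ, ((sumTo 5 g : ℕ) : ZMod 2) = ∑ i : Fin 5, (g i : ZMod 2) := fun g => by
    rw [sumTo_eq, Nat.cast_sum, ← Fin.sum_univ_eq_sum_range (fun i => (g i : ZMod 2))]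
  simp only [codeSpace, ofTrilinear, trilinearForm_apply, evalCode, hsum, hb, codeCoeff_cast,
    Finset.mul_sum]

theorem codeSpace_σ (c : Code) {m : ℕ} (hm : m < 32) :
    (codeSpace c).σ (bitVec m) = bitVal (truthTable c) m := by
  rw [← evalCode_cast, bitVal, truthTable, Nat.testBit_ofBits_lt _ _ hm, Nat.testBit_zero]
  dsimp only
  rw [← ZMod.natCast_mod]
  rcases Nat.mod_two_eq_zero_or_one (evalCode c m) with h | h <;> simp [h]

theorem invariant_codeSpace (c : Code) :
    (codeSpace c).invariant = tableInvariant (truthTable c) := by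
  have hval : ∀ t m : ℕ, (bitVal t m).val = t >>> m % 2 := fun t m => by
    rw [bitVal, Nat.testBit_eq_decide_div_mod_eq, Nat.shiftRight_eq_div_pow]
    rcases Nat.mod_two_eq_zero_or_one (t / 2 ^ m) with h | h <;> simp [h, ZMod.val_one]
  have hn : ∀ u < 32, ∑ v, ((codeSpace c).σ v).val * ((codeSpace c).σ (bitVec u + v)).val =
      sumTo 32 fun v => (truthTable c >>> v % 2) * (truthTable c >>> (u ^^^ v) % 2) := by
    intro u hu
    rw [sum_bitVec, sumTo_eq, sumTo_eq]
    refine Finset.sum_congr rfl fun v hv => ?_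
    rw [Finset.mem_range] at hv
    rw [← bitVec_xor, codeSpace_σ c hv, codeSpace_σ c (Nat.xor_lt_two_pow (n := 5) hu hv), hval,
      hval]
  rw [invariant, sum_bitVec, tableInvariant, sumTo_eq, sumTo_eq]
  refine Finset.sum_congr rfl fun u hu => ?_
  rw [Finset.mem_range] at hu
  rw [hn u hu, codeSpace_σ c hu, hval]

/-- Different codes in normal form belong to nonisomorphic spaces. -/
theorem normalCodes_inj {i j : Fin normalCodes.length}
    (h : (codeSpace (normalCodes.get i)).Isomorphic (codeSpace (normalCodes.get j))) : i = j := by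
  have h1 := h.invariant_eq
  rw [invariant_codeSpace, invariant_codeSpace] at h1
  have h2 := (List.nodup_iff_injective_get.1 tableInvariant_nodup)
    (a₁ := i.cast (by simp)) (a₂ := j.cast (by simp)) (by simpa using h1)
  simpa [Fin.ext_iff] using h2

/-- A loop is nonassociative if and only if `α` is nonzero on its space. -/
theorem IsSpaceOf.isNonassociative_iff {V : Type*} [AddCommGroup V] [Module (ZMod 2) V]
    {S : SymplecticCubicSpace V} {L : Type*} [MulOneClass L] (hL : IsLoop L) (h : S.IsSpaceOf L) :
    IsNonassociative L ↔ ∃ u v w, S.α ![u, v, w] ≠ 0 := by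
  obtain ⟨π, ε, hπ, -, hε, -, -, -, hα⟩ := h
  have key : ∀ x y z, (x * y) * z = x * (y * z) ↔
      S.α ![(π x).toAdd, (π y).toAdd, (π z).toAdd] = 0 := fun x y z => by
    rw [hα x y z]
    refine ⟨fun h => ?_, fun h => by rw [h, ofAdd_zero, map_one, mul_one]⟩
    have h1 := (hL.left_bijective (x * (y * z))).1 (h.trans (mul_one _).symm)
    exact hε (h1.trans (map_one ε).symm)
  constructor
  · rintro ⟨x, y, z, hne⟩
    exact ⟨_, _, _, fun h => hne ((key x y z).2 h)⟩
  · rintro ⟨u, v, w, hne⟩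
    obtain ⟨x, hx⟩ := hπ (.ofAdd u)
    obtain ⟨y, hy⟩ := hπ (.ofAdd v)
    obtain ⟨z, hz⟩ := hπ (.ofAdd w)
    refine ⟨x, y, z, fun h => hne ?_⟩
    have := (key x y z).1 h
    rwa [hx, hy, hz, toAdd_ofAdd, toAdd_ofAdd, toAdd_ofAdd] at this

theorem fst_mem_baseForms : ∀ c ∈ normalCodes, c.1 ∈ baseForms := by
  decide +kernel

theorem codeSpace_α_ne_zero {c : Code} (hc : c ∈ normalCodes) :
    ∃ u v w, (codeSpace c).α ![u, v, w] ≠ 0 := by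
  have key : ∀ a ∈ baseForms, ∃ p q r : Fin 5, p ≠ q ∧ q ≠ r ∧ p ≠ r ∧
      a.testBit (2 ^ p.val + 2 ^ q.val + 2 ^ r.val) = true := by decide +kernel
  obtain ⟨p, q, r, hpq, hqr, hpr, h⟩ := key _ (fst_mem_baseForms c hc)
  refine ⟨stdVec p, stdVec q, stdVec r, ?_⟩
  rw [(codeSpace_hasCode c).α p q r hpq hqr hpr, bitVal, if_pos h]
  exact one_ne_zero

theorem σ_ne_zero {V : Type*} [AddCommGroup V] [Module (ZMod 2) V] (S : SymplecticCubicSpace V)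
    (h : ∃ u v w, S.α ![u, v, w] ≠ 0) : S.σ ≠ 0 := by
  rintro h0
  obtain ⟨u, v, w, h⟩ := h
  refine h ?_
  simp [α_eq, κ_eq, h0]

/-- Two code loops of the same order are isomorphic if and only if their spaces are. -/
theorem nonempty_mulEquiv_iff {L M : Type*} [MulOneClass L] [MulOneClass M] {n : ℕ}
    {S T : SymplecticCubicSpace (Fin n → ZMod 2)} (hL : IsCodeLoop L n) (hM : IsCodeLoop M n)
    (hS : S.IsSpaceOf L) (hT : T.IsSpaceOf M) : Nonempty (L ≃* M) ↔ S.Isomorphic T :=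
  ⟨fun ⟨φ⟩ => isomorphic_of_mulEquiv hL.isLoop hS hT φ, fun h =>
    IsSpaceOf.nonempty_mulEquiv hL.isLoop hM.isLoop hS (hT.of_isomorphic h)⟩

end SymplecticCubicSpace

theorem mainTheorem1 :
    -- Every code loop of order 64 has a symplectic cubic space of dimension 5,
    (∀ (L : Type u) [MulOneClass L], IsCodeLoop L 5 →
      ∃ S : SymplecticCubicSpace (Fin 5 → ZMod 2), S.IsSpaceOf L) ∧
    -- every nonzero symplectic cubic space of dimension 5 comes from such a loop,
    (∀ S : SymplecticCubicSpace (Fin 5 → ZMod 2), S.σ ≠ 0 →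
      ∃ (L : Type) (_ : MulOneClass L), IsCodeLoop L 5 ∧ S.IsSpaceOf L) ∧
    -- and isomorphic loops correspond to isomorphic spaces.
    (∀ (L : Type u) (M : Type v) [MulOneClass L] [MulOneClass M]
      (S T : SymplecticCubicSpace (Fin 5 → ZMod 2)), IsCodeLoop L 5 → IsCodeLoop M 5 →
      S.IsSpaceOf L → T.IsSpaceOf M → (Nonempty (L ≃* M) ↔ S.Isomorphic T)) ∧
    -- There are exactly 80 nonassociative code loops of order 64 up to isomorphism.
    (∃ (C : Fin 80 → Type) (_ : ∀ i, MulOneClass (C i)),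
      (∀ i, IsCodeLoop (C i) 5 ∧ IsNonassociative (C i)) ∧
      (∀ i j, Nonempty (C i ≃* C j) → i = j) ∧
      ∀ (L : Type u) [MulOneClass L], IsCodeLoop L 5 → IsNonassociative L →
        ∃ i, Nonempty (L ≃* C i)) := by
  refine ⟨fun L _ hL => hL.exists_isSpaceOf, fun S hS => S.exists_isCodeLoop hS,
    fun L M _ _ S T hL hM hS hT =>
      SymplecticCubicSpace.nonempty_mulEquiv_iff hL hM hS hT, ?_⟩
  let S : Fin 80 → SymplecticCubicSpace (Fin 5 → ZMod 2) := fun i =>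
    SymplecticCubicSpace.codeSpace
      (SymplecticCubicSpace.normalCodes.get (i.cast SymplecticCubicSpace.normalCodes_length.symm))
  have hα : ∀ i, ∃ u v w, (S i).α ![u, v, w] ≠ 0 := fun i =>
    SymplecticCubicSpace.codeSpace_α_ne_zero (List.get_mem _ _)
  choose C inst hC hSC using fun i => (S i).exists_isCodeLoop ((S i).σ_ne_zero (hα i))
  refine ⟨C, inst, fun i => ⟨hC i, ((hSC i).isNonassociative_iff (hC i).isLoop).2 (hα i)⟩,
    fun i j h => ?_, fun L _ hL hna => ?_⟩
  · have h1 := (SymplecticCubicSpace.nonempty_mulEquiv_iff (hC i) (hC j) (hSC i) (hSC j)).1 h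
    simpa [Fin.ext_iff] using SymplecticCubicSpace.normalCodes_inj h1
  · obtain ⟨T, hT⟩ := hL.exists_isSpaceOf
    obtain ⟨c, hc, hiso⟩ := T.exists_normalCode ((hT.isNonassociative_iff hL.isLoop).1 hna)
    obtain ⟨i, rfl⟩ := List.mem_iff_get.1 hc
    exact ⟨i.cast SymplecticCubicSpace.normalCodes_length,
      (SymplecticCubicSpace.nonempty_mulEquiv_iff hL (hC _) hT (hSC _)).2 hiso⟩
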